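/- Let $d\ge 1$ and $1\le \ell\le d$ be integers and let $\pi(dx)=\exp(-U(x))\,dx$ be a probability measure on $\mathbb{R}^d$, where $U:\mathbb{R}^d\to\mathbb{R}$ is differentiable, $L$-smooth (that is, $\|\nabla U(x)-\nabla U(y)\|\le L\|x-y\|$ for all $x,y$) and $\lambda$-convex with $\lambda>0$ (that is, $x\mapsto U(x)-\frac{\lambda}{2}\|x\|^2$ is convex). Put $\kappa=L/\lambda$. Let $V_\ell(\mathbb{R}^d)$ be the set of orthonormal $\ell$-frames $\mathbf{v}=(v_1,\dots,v_\ell)$ in $\mathbb{R}^d$ and let $\sigma^{(\ell)}$ be the uniform probability measure on it (the Haar probability measure, invariant under the orthogonal group $O(d)$). Let $P^{\mathrm{HR},\ell}$ be the $\ell$-dimensional Hit-and-Run Markov kernel: given $x\in\mathbb{R}^d$, a sample $y\sim P^{\mathrm{HR},\ell}(x,\cdot)$ is obtained by drawing $\mathbf{v}\sim\sigma^{(\ell)}$, then drawing $s\in\mathbb{R}^\ell$ with Lebesgue density proportional to $s\mapsto\exp\bigl(-U(x+\sum_{i=1}^\ell s_iv_i)\bigr)$, and setting $y=x+\sum_{i=1}^\ell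 s_iv_i$. For probability measures $\mu,\nu$ on $\mathbb{R}^d$ let $\mathrm{KL}(\mu|\nu)=\int\log\frac{d\mu}{d\nu}\,d\mu\in[0,+\infty]$ if $\mu\ll\nu$ and $\mathrm{KL}(\mu|\nu)=+\infty$ otherwise. Then for every Borel probability measure $\mu$ on $\mathbb{R}^d$, with $\mu P^{\mathrm{HR},\ell}(A)=\int P^{\mathrm{HR},\ell}(x,A)\,\mu(dx)$ and the convention $0\cdot\infty=0$, $$\mathrm{KL}(\mu P^{\mathrm{HR},\ell}\,|\,\pi)\;\le\;\Bigl(1-\frac{\ell}{\kappa d}\Bigr)\,\mathrm{KL}(\mu\,|\,\pi).$$ -/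

import Mathlib

open MeasureTheory ProbabilityTheory
open scoped ENNReal InnerProductSpace

namespace HitAndRun

/-- The probability density `exp (-U)` as a measure on `ℝ^d`: `π(dx) = exp (-U x) dx`. -/
noncomputable def target {d : ℕ} (U : EuclideanSpace ℝ (Fin d) → ℝ) :
    Measure (EuclideanSpace ℝ (Fin d)) :=
  volume.withDensity fun x => ENNReal.ofReal (Real.exp (-U x))

/-- `U` is `lam`-convex with `lam > 0` and `L`-smooth. -/
structure ConvexSmooth {d : ℕ} (U : EuclideanSpace ℝ (Fin d) → ℝ) (lam L : ℝ) : Prop where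
  lam_pos : 0 < lam
  differentiable : Differentiable ℝ U
  lipschitz_gradient : ∀ x y, ‖gradient U x - gradient U y‖ ≤ L * ‖x - y‖
  convex : ConvexOn ℝ Set.univ fun x => U x - lam / 2 * ‖x‖ ^ 2

theorem ConvexSmooth.measurable {d : ℕ} {U : EuclideanSpace ℝ (Fin d) → ℝ} {lam L : ℝ}
    (h : ConvexSmooth U lam L) : Measurable U :=
  h.differentiable.continuous.measurable

/-! ### The uniform measure on orthonormal frames -/

/-- The Stiefel manifold `V_ℓ(ℝ^d)` of orthonormal `ℓ`-frames in `ℝ^d`. -/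
abbrev Stiefel (d ℓ : ℕ) : Type :=
  {v : Fin ℓ → EuclideanSpace ℝ (Fin d) // Orthonormal ℝ v}

instance orthogonalMeasurableSpace (d : ℕ) :
    MeasurableSpace (Matrix.orthogonalGroup (Fin d) ℝ) := borel _

instance orthogonalBorelSpace (d : ℕ) : BorelSpace (Matrix.orthogonalGroup (Fin d) ℝ) := ⟨rfl⟩

instance orthogonalCompactSpace (d : ℕ) : CompactSpace (Matrix.orthogonalGroup (Fin d) ℝ) := by
  have hK : IsCompact (Set.univ.pi fun _ : Fin d => Set.univ.pi fun _ : Fin d =>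
      Metric.closedBall (0 : ℝ) 1) :=
    isCompact_univ_pi fun _ => isCompact_univ_pi fun _ => isCompact_closedBall _ _
  have hcl : IsClosed (Matrix.orthogonalGroup (Fin d) ℝ : Set (Matrix (Fin d) (Fin d) ℝ)) := by
    have : (Matrix.orthogonalGroup (Fin d) ℝ : Set (Matrix (Fin d) (Fin d) ℝ))
        = {A | A * A.transpose = 1} := by
      ext A
      exact Matrix.mem_orthogonalGroup_iff _ _
    rw [this]
    exact isClosed_eq (by fun_prop) continuous_const
  refine isCompact_iff_compactSpace.mp (hK.of_isClosed_subset hcl fun A hA => ?_)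
  intro i _ j _
  simpa using entry_norm_bound_of_unitary hA i j

/-- The Haar probability measure on the orthogonal group `O(d)`. -/
noncomputable def orthogonalHaar (d : ℕ) : Measure (Matrix.orthogonalGroup (Fin d) ℝ) :=
  Measure.haarMeasure ⊤

/-- The orthonormal `ℓ`-frame formed by the first `ℓ` columns of an orthogonal matrix. -/
noncomputable def firstColumns {d ℓ : ℕ} (hℓ : ℓ ≤ d) (A : Matrix.orthogonalGroup (Fin d) ℝ) :
    Stiefel d ℓ :=
  ⟨fun i => WithLp.toLp 2 fun k => (A : Matrix (Fin d) (Fin d) ℝ) k (Fin.castLE hℓ i), by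
    rw [orthonormal_iff_ite]
    intro i j
    have h := congrFun (congrFun ((Matrix.mem_orthogonalGroup_iff' _ _).mp A.2)
      (Fin.castLE hℓ i)) (Fin.castLE hℓ j)
    simp only [Matrix.mul_apply, Matrix.transpose_apply, Matrix.one_apply,
      Fin.castLE_inj] at h
    rw [← h, PiLp.inner_apply]
    exact Finset.sum_congr rfl fun k _ => by simp [mul_comm]⟩

theorem measurable_firstColumns {d ℓ : ℕ} (hℓ : ℓ ≤ d) :
    Measurable (firstColumns hℓ : Matrix.orthogonalGroup (Fin d) ℝ → Stiefel d ℓ) := by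
  have : Continuous (firstColumns hℓ : Matrix.orthogonalGroup (Fin d) ℝ → Stiefel d ℓ) := by
    refine Continuous.subtype_mk (continuous_pi fun i => ?_) _
    refine (PiLp.continuous_toLp 2 _).comp (continuous_pi fun k => ?_)
    exact continuous_subtype_val.matrix_elem k _
  exact this.measurable

/-- The uniform (Haar) probability measure `σ^(ℓ)` on the Stiefel manifold: the law of the first
`ℓ` columns of a Haar-distributed orthogonal matrix. -/
noncomputable def uniformFrame {d ℓ : ℕ} (hℓ : ℓ ≤ d) : Measure (Stiefel d ℓ) :=
  (orthogonalHaar d).map (firstColumns hℓ)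

instance orthogonalHaar_isProbabilityMeasure (d : ℕ) :
    IsProbabilityMeasure (orthogonalHaar d) :=
  ⟨by
    have h := Measure.haarMeasure_self
      (K₀ := (⊤ : TopologicalSpace.PositiveCompacts (Matrix.orthogonalGroup (Fin d) ℝ)))
    rwa [TopologicalSpace.PositiveCompacts.coe_top] at h⟩

instance uniformFrame_isProbabilityMeasure {d ℓ : ℕ} (hℓ : ℓ ≤ d) :
    IsProbabilityMeasure (uniformFrame hℓ) :=
  Measure.isProbabilityMeasure_map (measurable_firstColumns hℓ).aemeasurable

/-- The action of `O(d)` on orthonormal frames. -/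
noncomputable def rotate {d ℓ : ℕ} (O : Matrix.orthogonalGroup (Fin d) ℝ) (v : Stiefel d ℓ) :
    Stiefel d ℓ :=
  ⟨fun i => WithLp.toLp 2 ((O : Matrix (Fin d) (Fin d) ℝ).mulVec (v.1 i).ofLp), by
    have hv := orthonormal_iff_ite.mp v.2
    rw [orthonormal_iff_ite]
    intro i j
    rw [← hv i j, EuclideanSpace.inner_eq_star_dotProduct, EuclideanSpace.inner_eq_star_dotProduct]
    simp only [star_trivial]
    rw [Matrix.dotProduct_mulVec, Matrix.vecMul_mulVec]
    rw [(Matrix.mem_orthogonalGroup_iff' _ _).mp O.2, Matrix.vecMul_one]⟩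

/-- `σ^(ℓ)` is invariant under `O(d)`. -/
theorem map_rotate_uniformFrame {d ℓ : ℕ} (hℓ : ℓ ≤ d) (O : Matrix.orthogonalGroup (Fin d) ℝ) :
    (uniformFrame hℓ).map (rotate O) = uniformFrame hℓ := by
  have hrot : Measurable (rotate O : Stiefel d ℓ → Stiefel d ℓ) := by
    have : Continuous (rotate O : Stiefel d ℓ → Stiefel d ℓ) := by
      refine Continuous.subtype_mk (continuous_pi fun i => ?_) _
      refine (PiLp.continuous_toLp 2 _).comp (Continuous.matrix_mulVec continuous_const ?_)
      exact (PiLp.continuous_ofLp 2 _).comp ((continuous_apply i).comp continuous_subtype_val)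
    exact this.measurable
  have hO : Measurable fun A : Matrix.orthogonalGroup (Fin d) ℝ => O * A :=
    (continuous_const.mul continuous_id).measurable
  have hcomp : (rotate O : Stiefel d ℓ → Stiefel d ℓ) ∘ firstColumns hℓ
      = firstColumns hℓ ∘ fun A => O * A := by
    funext A
    apply Subtype.ext
    funext i
    rfl
  have hinv : (orthogonalHaar d).map (fun A => O * A) = orthogonalHaar d :=
    map_mul_left_eq_self (Measure.haarMeasure ⊤) O
  rw [uniformFrame, Measure.map_map hrot (measurable_firstColumns hℓ), hcomp,
    ← Measure.map_map (measurable_firstColumns hℓ) hO, hinv]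

/-! ### The Hit-and-Run kernel -/

/-- The point `x + ∑ i, s i • v i` of the affine subspace through `x` spanned by the frame `v`. -/
noncomputable def framePoint {d ℓ : ℕ} (x : EuclideanSpace ℝ (Fin d)) (v : Stiefel d ℓ)
    (s : EuclideanSpace ℝ (Fin ℓ)) : EuclideanSpace ℝ (Fin d) :=
  x + ∑ i, s i • v.1 i

/-- The law of `y = x + ∑ i, s i • v i` when `s ∈ ℝ^ℓ` has Lebesgue density proportional to
`exp (-U (x + ∑ i, s i • v i))`. -/
noncomputable def frameUpdate {d ℓ : ℕ} (U : EuclideanSpace ℝ (Fin d) → ℝ)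
    (x : EuclideanSpace ℝ (Fin d)) (v : Stiefel d ℓ) : Measure (EuclideanSpace ℝ (Fin d)) :=
  ((volume : Measure (EuclideanSpace ℝ (Fin ℓ))).tilted fun s => -U (framePoint x v s)).map
    (framePoint x v)

theorem continuous_framePoint {d ℓ : ℕ} :
    Continuous fun p : (EuclideanSpace ℝ (Fin d) × Stiefel d ℓ) × EuclideanSpace ℝ (Fin ℓ) =>
      framePoint p.1.1 p.1.2 p.2 := by
  unfold framePoint
  refine (continuous_fst.comp continuous_fst).add (continuous_finsetSum _ fun i _ => ?_)
  refine Continuous.smul ((continuous_apply i).comp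
    ((PiLp.continuous_ofLp 2 _).comp continuous_snd)) ?_
  exact (continuous_apply i).comp
    (continuous_subtype_val.comp (continuous_snd.comp continuous_fst))

theorem measurable_frameUpdate {d ℓ : ℕ} {U : EuclideanSpace ℝ (Fin d) → ℝ} (hU : Measurable U) :
    Measurable fun p : EuclideanSpace ℝ (Fin d) × Stiefel d ℓ => frameUpdate U p.1 p.2 := by
  have hpt := (continuous_framePoint (d := d) (ℓ := ℓ)).measurable
  have hexp : Measurable fun p :
      (EuclideanSpace ℝ (Fin d) × Stiefel d ℓ) × EuclideanSpace ℝ (Fin ℓ) =>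
      Real.exp (-U (framePoint p.1.1 p.1.2 p.2)) := by
    exact (hU.comp hpt).neg.exp
  have hZ : Measurable fun p : EuclideanSpace ℝ (Fin d) × Stiefel d ℓ =>
      ∫ s : EuclideanSpace ℝ (Fin ℓ), Real.exp (-U (framePoint p.1 p.2 s)) :=
    (hexp.stronglyMeasurable.integral_prod_right (ν := volume)).measurable
  refine Measure.measurable_of_measurable_coe _ fun A hA => ?_
  have hsec (p : EuclideanSpace ℝ (Fin d) × Stiefel d ℓ) : Measurable (framePoint p.1 p.2) :=
    hpt.comp measurable_prodMk_left
  have hform (p : EuclideanSpace ℝ (Fin d) × Stiefel d ℓ) : frameUpdate U p.1 p.2 A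
      = ∫⁻ s : EuclideanSpace ℝ (Fin ℓ), A.indicator (fun _ => (1 : ℝ≥0∞)) (framePoint p.1 p.2 s) *
        ENNReal.ofReal (Real.exp (-U (framePoint p.1 p.2 s)) /
          ∫ t : EuclideanSpace ℝ (Fin ℓ), Real.exp (-U (framePoint p.1 p.2 t))) := by
    rw [frameUpdate, Measure.map_apply (hsec p) hA, tilted_apply' _ _ (hsec p hA),
      ← lintegral_indicator (hsec p hA)]
    refine lintegral_congr fun s => ?_
    by_cases hs : framePoint p.1 p.2 s ∈ A <;> simp [Set.indicator, hs]
  simp only [hform]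
  refine Measurable.lintegral_prod_right' (f := fun p :
      (EuclideanSpace ℝ (Fin d) × Stiefel d ℓ) × EuclideanSpace ℝ (Fin ℓ) =>
      A.indicator (fun _ => (1 : ℝ≥0∞)) (framePoint p.1.1 p.1.2 p.2) *
        ENNReal.ofReal (Real.exp (-U (framePoint p.1.1 p.1.2 p.2)) /
          ∫ t : EuclideanSpace ℝ (Fin ℓ), Real.exp (-U (framePoint p.1.1 p.1.2 t)))) ?_
  exact ((measurable_const.indicator hA).comp hpt).mul
    (hexp.div (hZ.comp measurable_fst)).ennreal_ofReal

/-- The `ℓ`-dimensional Hit-and-Run kernel: from `x`, draw a uniform orthonormal `ℓ`-frame `v`,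
then move to a point drawn from `π ∝ exp (-U)` restricted to the affine subspace `x + span v`. -/
noncomputable def hitAndRun {d ℓ : ℕ} (U : EuclideanSpace ℝ (Fin d) → ℝ) (hU : Measurable U)
    (hℓ : ℓ ≤ d) : Kernel (EuclideanSpace ℝ (Fin d)) (EuclideanSpace ℝ (Fin d)) where
  toFun x := (uniformFrame hℓ).bind fun v => frameUpdate U x v
  measurable' := by
    have hm := measurable_frameUpdate (ℓ := ℓ) hU
    refine Measure.measurable_of_measurable_coe _ fun A hA => ?_
    have h (x : EuclideanSpace ℝ (Fin d)) :
        (uniformFrame hℓ).bind (fun v => frameUpdate U x v) A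
          = ∫⁻ v, frameUpdate U x v A ∂(uniformFrame hℓ) :=
      Measure.bind_apply hA (hm.comp measurable_prodMk_left).aemeasurable
    simp only [h]
    exact Measurable.lintegral_prod_right' (ν := uniformFrame hℓ)
      (f := fun p : EuclideanSpace ℝ (Fin d) × Stiefel d ℓ => frameUpdate U p.1 p.2 A)
      ((Measure.measurable_coe hA).comp hm)

theorem hitAndRun_apply {d ℓ : ℕ} {U : EuclideanSpace ℝ (Fin d) → ℝ} (hU : Measurable U)
    (hℓ : ℓ ≤ d) (x : EuclideanSpace ℝ (Fin d)) {A : Set (EuclideanSpace ℝ (Fin d))}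
    (hA : MeasurableSet A) :
    hitAndRun U hU hℓ x A = ∫⁻ v, frameUpdate U x v A ∂(uniformFrame hℓ) :=
  Measure.bind_apply hA ((measurable_frameUpdate hU).comp measurable_prodMk_left).aemeasurable

/-! ### Under the assumptions all the normalizing constants are finite -/

theorem ConvexSmooth.lower_bound {d : ℕ} {U : EuclideanSpace ℝ (Fin d) → ℝ} {lam L : ℝ}
    (h : ConvexSmooth U lam L) (x w : EuclideanSpace ℝ (Fin d)) :
    U x + fderiv ℝ U x w + lam / 2 * ‖w‖ ^ 2 ≤ U (x + w) := by
  have hd : HasDerivAt (fun t : ℝ => U (x + t • w)) (fderiv ℝ U x w) 0 := by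
    have h1 : HasFDerivAt U (fderiv ℝ U x) (x + (0 : ℝ) • w) := by
      simpa using (h.differentiable x).hasFDerivAt
    have h2 : HasDerivAt (fun t : ℝ => x + t • w) w 0 := by
      simpa using ((hasDerivAt_id (0 : ℝ)).smul_const w).const_add x
    exact h1.comp_hasDerivAt 0 h2
  have hlim := hd.tendsto_slope_zero_right
  have hrhs : Filter.Tendsto (fun t : ℝ => U (x + w) - U x - lam / 2 * (1 - t) * ‖w‖ ^ 2)
      (nhdsWithin 0 (Set.Ioi 0)) (nhds (U (x + w) - U x - lam / 2 * (1 - 0) * ‖w‖ ^ 2)) := by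
    refine Filter.Tendsto.mono_left (Continuous.tendsto ?_ 0) nhdsWithin_le_nhds
    fun_prop
  have hle : ∀ᶠ t in nhdsWithin (0 : ℝ) (Set.Ioi 0),
      t⁻¹ • (U (x + (0 + t) • w) - U (x + (0 : ℝ) • w))
      ≤ U (x + w) - U x - lam / 2 * (1 - t) * ‖w‖ ^ 2 := by
    filter_upwards [Ioo_mem_nhdsGT (zero_lt_one : (0 : ℝ) < 1)] with t ht
    have hc := h.convex.2 (Set.mem_univ x) (Set.mem_univ (x + w)) (sub_nonneg.mpr ht.2.le) ht.1.le
      (by ring)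
    have e : (1 - t) • x + t • (x + w) = x + t • w := by module
    rw [e] at hc
    have n1 : ‖x + t • w‖ ^ 2 = ‖x‖ ^ 2 + 2 * (t * ⟪x, w⟫_ℝ) + t ^ 2 * ‖w‖ ^ 2 := by
      rw [norm_add_sq_real, real_inner_smul_right, norm_smul, mul_pow, Real.norm_eq_abs, sq_abs]
    have n2 : ‖x + w‖ ^ 2 = ‖x‖ ^ 2 + 2 * ⟪x, w⟫_ℝ + ‖w‖ ^ 2 := norm_add_sq_real x w
    dsimp only at hc
    rw [n1, n2] at hc
    simp only [smul_eq_mul, zero_add, zero_smul, add_zero] at hc ⊢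
    rw [inv_mul_le_iff₀ ht.1]
    linarith
  have := le_of_tendsto_of_tendsto hlim hrhs hle
  linarith

theorem ConvexSmooth.integrable_exp_frame {d ℓ : ℕ} {U : EuclideanSpace ℝ (Fin d) → ℝ}
    {lam L : ℝ} (h : ConvexSmooth U lam L) (x : EuclideanSpace ℝ (Fin d)) (v : Stiefel d ℓ) :
    Integrable fun s : EuclideanSpace ℝ (Fin ℓ) => Real.exp (-U (framePoint x v s)) := by
  have hcont : Continuous (framePoint x v) :=
    continuous_framePoint.comp (Continuous.prodMk_right (x, v))
  let w : EuclideanSpace ℝ (Fin ℓ) := WithLp.toLp 2 fun i => fderiv ℝ U x (v.1 i)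
  have hG : Integrable fun s : EuclideanSpace ℝ (Fin ℓ) =>
      Real.exp (-U x) * Real.exp (-(lam / 2) * ‖s‖ ^ 2 + (-1) * ⟪w, s⟫_ℝ) := by
    refine Integrable.const_mul ?_ _
    have hb : 0 < ((lam / 2 : ℝ) : ℂ).re := by
      rw [Complex.ofReal_re]
      exact half_pos h.lam_pos
    have hi := (GaussianFourier.integrable_cexp_neg_mul_sq_norm_add hb (-1) w).norm
    refine hi.congr (Filter.Eventually.of_forall fun s => ?_)
    dsimp only
    rw [Complex.norm_exp]
    congr 1
    norm_cast
  refine hG.mono' ((h.differentiable.continuous.comp hcont).neg.rexp.aestronglyMeasurable)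
    (Filter.Eventually.of_forall fun s => ?_)
  rw [Real.norm_eq_abs, Real.abs_exp, ← Real.exp_add]
  refine Real.exp_le_exp.mpr ?_
  have hb := h.lower_bound x (∑ i, s i • v.1 i)
  have hn : ‖∑ i, s i • v.1 i‖ ^ 2 = ‖s‖ ^ 2 := by
    rw [← real_inner_self_eq_norm_sq, v.2.inner_sum, EuclideanSpace.norm_sq_eq]
    exact Finset.sum_congr rfl fun i _ => by simp [sq]
  have hf : fderiv ℝ U x (∑ i, s i • v.1 i) = ⟪w, s⟫_ℝ := by
    rw [map_sum, PiLp.inner_apply]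
    exact Finset.sum_congr rfl fun i _ => by simp [w]
  rw [hn, hf] at hb
  change -U (x + ∑ i, s i • v.1 i) ≤ _
  linarith

theorem ConvexSmooth.isProbabilityMeasure_frameUpdate {d ℓ : ℕ}
    {U : EuclideanSpace ℝ (Fin d) → ℝ} {lam L : ℝ} (h : ConvexSmooth U lam L)
    (x : EuclideanSpace ℝ (Fin d)) (v : Stiefel d ℓ) :
    IsProbabilityMeasure (frameUpdate U x v) := by
  have hcont : Continuous (framePoint x v) :=
    continuous_framePoint.comp (Continuous.prodMk_right (x, v))
  have := isProbabilityMeasure_tilted (h.integrable_exp_frame x v)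
  exact Measure.isProbabilityMeasure_map hcont.measurable.aemeasurable

/-- Under the standing assumptions `hitAndRun` is a Markov kernel. -/
theorem ConvexSmooth.isMarkovKernel_hitAndRun {d ℓ : ℕ} {U : EuclideanSpace ℝ (Fin d) → ℝ}
    {lam L : ℝ} (h : ConvexSmooth U lam L) (hℓ : ℓ ≤ d) :
    IsMarkovKernel (hitAndRun U h.measurable hℓ) := by
  refine ⟨fun x => ⟨?_⟩⟩
  rw [hitAndRun_apply _ _ _ MeasurableSet.univ]
  have (v : Stiefel d ℓ) : frameUpdate U x v Set.univ = 1 :=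
    (h.isProbabilityMeasure_frameUpdate x v).measure_univ
  simp [this]

end HitAndRun

namespace HitAndRun

/-! ### Monotone transport on the line -/

section Line

open Filter Topology Set

/-! By duality it suffices to bound `∫ f d(μP)` for bounded `f` with `∫ exp f dπ ≤ 1`
(`klDiv_le_of_forall_integral_le`). This integral is the average over frames `v` of `∫ Q_v f dμ`,
where `Q_v` resamples along `v`. The function `Q_v f` is constant along `span v`, and it still
satisfies `∫ exp (Q_v f) dπ ≤ 1`, by Jensen and the invariance of `π` under `Q_v`.

A uniform frame can be read off from any `ℓ` columns of a Haar orthogonal matrix. Using the `d`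
cyclic shifts of a block of `ℓ` columns, each column serves exactly `ℓ` times. The theorem thereby
reduces to an inequality in one fixed orthonormal basis: if `S_1, …, S_N` cover each index `ℓ`
times, and `g_j` does not depend on the coordinates in `S_j` and has `∫ exp g_j dπ ≤ 1`, then `∑ ∫
g_j dμ ≤ (N - ℓ/κ) KL(μ|π)` (`ConvexSmooth.sum_integral_le_of_basis`). Taking `N = d` and dividing
by `d` gives the rate.

This inequality is proved by transport (`sum_integral_le_of_interpolation`). Let `T` be the Knothe
map from `μ` to `π`, and let `Φ_j` move only the coordinates in `S_j`, for time `t = 1/κ`, from the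
identity towards `T`. Then `g_j ∘ Φ_j = g_j`. Since `T` is triangular with increasing diagonal, so
is `Φ_j`, and its Jacobian is the product of the factors `(1 - t) + t ∂_i T_i` over `i ∈ S_j`.
Changing variables in `∫ exp g_j dπ ≤ 1` and using `log b ≤ b - 1` bounds `∫ g_j dμ` by the entropy,
plus the mean increase of `U` along `Φ_j`, minus the mean log-Jacobian. Concavity of `log` bounds
the latter below by `t ∑_{i ∈ S_j} log ∂_i T_i`.

Summed over `j`, the Jacobian terms give `tℓ ∑ log ∂_i T_i`, which the Jacobian equation for `T`
turns into `tℓ` times the log-density plus `tℓ (U ∘ T - U)`. The increases of `U` sum to at most `tℓ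
(U ∘ T - U)` (`ConvexSmooth.sum_sub_le`): smoothness costs `L t²/2` per squared coordinate
displacement, strong convexity yields `t lam/2`, and the two agree exactly at `t = lam/L`. So the
potential cancels. -/

theorem continuous_cdf (μ : Measure ℝ) [IsProbabilityMeasure μ] [NullSingletonClass μ] :
    Continuous (cdf μ) := by
  refine continuous_iff_continuousAt.2 fun x => ?_
  rw [(monotone_cdf μ).continuousAt_iff_leftLim_eq_rightLim, (cdf μ).rightLim_eq]
  have h : (cdf μ).measure {x} = 0 := by rw [measure_cdf]; exact measure_singleton x
  rw [StieltjesFunction.measure_singleton, ENNReal.ofReal_eq_zero] at h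
  exact le_antisymm ((monotone_cdf μ).leftLim_le le_rfl) (by linarith)

/-- A continuous cdf pushes its measure to the uniform law: when nonempty, the sublevel set is a
closed half-line at whose endpoint the cdf equals `u`. The bound `u < 1` keeps the set bounded
above. -/
theorem measure_cdf_le (μ : Measure ℝ) [IsProbabilityMeasure μ] [NullSingletonClass μ] {u : ℝ}
    (h0 : 0 ≤ u) (h1 : u < 1) : μ {x | cdf μ x ≤ u} = ENNReal.ofReal u := by
  have hcont := continuous_cdf μ
  rcases Set.eq_empty_or_nonempty {x | cdf μ x ≤ u} with he | hne
  · rcases h0.eq_or_lt with rfl | hpos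
    · simp [he]
    · obtain ⟨x, hx⟩ := ((tendsto_cdf_atBot μ).eventually (gt_mem_nhds hpos)).exists
      exact absurd (show x ∈ {x | cdf μ x ≤ u} from hx.le) (by simp [he])
  · obtain ⟨b, hb⟩ := ((tendsto_cdf_atTop μ).eventually (lt_mem_nhds h1)).exists
    have hbdd : BddAbove {x | cdf μ x ≤ u} := by
      refine ⟨b, fun x hx => ?_⟩
      by_contra hlt
      exact absurd ((monotone_cdf μ (not_le.1 hlt).le).trans hx) (not_le.2 hb)
    have hclosed : IsClosed {x | cdf μ x ≤ u} := isClosed_le hcont continuous_const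
    set s := sSup {x | cdf μ x ≤ u} with hs
    have hmem : cdf μ s ≤ u := hclosed.csSup_mem hne hbdd
    have hset : {x | cdf μ x ≤ u} = Iic s := by
      ext x
      exact ⟨fun hx => le_csSup hbdd hx, fun hx => (monotone_cdf μ hx).trans hmem⟩
    have hge : u ≤ cdf μ s := by
      by_contra hlt
      obtain ⟨x, hx, hxs⟩ := ((hcont.continuousAt.eventually
        (gt_mem_nhds (not_le.1 hlt))).filter_mono nhdsWithin_le_nhds |>.and
        (self_mem_nhdsWithin : Ioi s ∈ 𝓝[>] s)).exists
      have : x ≤ s := le_csSup hbdd (show cdf μ x ≤ u from le_of_lt hx)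
      exact absurd hxs (not_lt.2 this)
    rw [hset, ← le_antisymm hmem hge, ofReal_cdf]

theorem ae_cdf_mem_Ioo (μ : Measure ℝ) [IsProbabilityMeasure μ] [NullSingletonClass μ] :
    ∀ᵐ x ∂μ, cdf μ x ∈ Ioo (0 : ℝ) 1 := by
  have h0 : ∀ᵐ x ∂μ, ¬ cdf μ x ≤ 0 := by
    rw [ae_iff]
    simpa using measure_cdf_le μ le_rfl zero_lt_one
  have hm : ∀ u : ℝ, MeasurableSet {x | cdf μ x ≤ u} := fun u =>
    (isClosed_le (continuous_cdf μ) continuous_const).measurableSet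
  have h1 : ∀ᵐ x ∂μ, ¬ 1 ≤ cdf μ x := by
    rw [ae_iff]
    simp only [not_not]
    refine le_antisymm (le_of_forall_pos_le_add fun ε hε => ?_) zero_le
    rcases le_or_gt 1 ε with h | h
    · exact prob_le_one.trans (by simpa using h)
    · have hεt : ε ≠ ∞ := (h.trans ENNReal.one_lt_top).ne
      have hε0 : 0 < ε.toReal := ENNReal.toReal_pos hε.ne' hεt
      have hε1 : ε.toReal < 1 := by
        rw [← ENNReal.toReal_one]
        exact (ENNReal.toReal_lt_toReal hεt ENNReal.one_ne_top).2 h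
      have hsub : {x | 1 ≤ cdf μ x} ⊆ {x | cdf μ x ≤ 1 - ε.toReal}ᶜ := by
        intro x hx hx'
        have h2 : (1 : ℝ) ≤ cdf μ x := hx
        have h3 : cdf μ x ≤ 1 - ε.toReal := hx'
        linarith
      refine (measure_mono hsub).trans ?_
      rw [prob_compl_eq_one_sub (hm _), measure_cdf_le μ (by linarith) (by linarith),
        ENNReal.ofReal_sub _ hε0.le, ENNReal.ofReal_one, ENNReal.ofReal_toReal hεt,
        ENNReal.sub_sub_cancel ENNReal.one_ne_top h.le, zero_add]
  filter_upwards [h0, h1] with x hx0 hx1 using ⟨not_le.1 hx0, not_le.1 hx1⟩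

/-- The increasing rearrangement carrying `μ` to `ν`. -/
noncomputable def rearrangement (μ ν : Measure ℝ) (x : ℝ) : ℝ :=
  open scoped Classical in
  if cdf μ x ∈ Ioo (0 : ℝ) 1 then sInf {y | cdf μ x ≤ cdf ν y} else 0

section

variable {μ ν : Measure ℝ} [IsProbabilityMeasure ν]

theorem setOf_le_cdf_eq_Ici_rearrangement [NullSingletonClass ν] {x : ℝ} (hx : cdf μ x ∈ Ioo (0 : ℝ) 1) :
    {y | cdf μ x ≤ cdf ν y} = Ici (rearrangement μ ν x) := by
  obtain ⟨a, ha⟩ := ((tendsto_cdf_atBot ν).eventually (gt_mem_nhds hx.1)).exists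
  obtain ⟨b, hb⟩ := ((tendsto_cdf_atTop ν).eventually (lt_mem_nhds hx.2)).exists
  have hbdd : BddBelow {y | cdf μ x ≤ cdf ν y} := by
    refine ⟨a, fun y hy => ?_⟩
    by_contra hlt
    exact absurd (le_trans hy (monotone_cdf ν (not_le.1 hlt).le)) (not_le.2 ha)
  have hclosed : IsClosed {y | cdf μ x ≤ cdf ν y} :=
    isClosed_le continuous_const (continuous_cdf ν)
  have hmem := hclosed.csInf_mem ⟨b, hb.le⟩ hbdd
  rw [rearrangement, if_pos hx]
  ext y
  exact ⟨fun hy => csInf_le hbdd hy, fun hy => le_trans hmem (monotone_cdf ν hy)⟩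

/-- This Galois connection is what monotonicity, measurability and the pushforward identity are read
off from. Levels strictly between 0 and 1 make the infimum a genuine, attained one. -/
theorem rearrangement_le_iff [NullSingletonClass ν] {x : ℝ} (hx : cdf μ x ∈ Ioo (0 : ℝ) 1) (y : ℝ) :
    rearrangement μ ν x ≤ y ↔ cdf μ x ≤ cdf ν y := by
  have := Set.ext_iff.1 (setOf_le_cdf_eq_Ici_rearrangement (ν := ν) hx) y
  exact this.symm

/-- Continuity excludes an overshoot: if the target cdf exceeded the level at the infimum, it would
exceed it slightly to the left too. Differentiating this identity yields the derivative of the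
rearrangement. -/
theorem cdf_rearrangement [NullSingletonClass ν] {x : ℝ} (hx : cdf μ x ∈ Ioo (0 : ℝ) 1) :
    cdf ν (rearrangement μ ν x) = cdf μ x := by
  refine le_antisymm ?_ ((rearrangement_le_iff hx _).1 le_rfl)
  by_contra hlt
  obtain ⟨y, hy, hys⟩ := (((continuous_cdf ν).continuousAt.eventually
    (lt_mem_nhds (not_le.1 hlt))).filter_mono nhdsWithin_le_nhds |>.and
    (self_mem_nhdsWithin : Iio (rearrangement μ ν x) ∈ 𝓝[<] _)).exists
  exact absurd ((rearrangement_le_iff hx y).2 (le_of_lt hy)) (not_le.2 hys)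

theorem monotoneOn_rearrangement [NullSingletonClass ν] :
    MonotoneOn (rearrangement μ ν) {x | cdf μ x ∈ Ioo (0 : ℝ) 1} := by
  intro x hx y hy hxy
  rw [rearrangement_le_iff hx, cdf_rearrangement hy]
  exact monotone_cdf μ hxy

theorem measurable_rearrangement [NullSingletonClass ν] : Measurable (rearrangement μ ν) := by
  have hI : MeasurableSet {x | cdf μ x ∈ Ioo (0 : ℝ) 1} :=
    (cdf μ).mono.measurable measurableSet_Ioo
  refine measurable_of_Iic fun y => ?_
  have : rearrangement μ ν ⁻¹' Iic y = ({x | cdf μ x ∈ Ioo (0 : ℝ) 1} ∩ {x | cdf μ x ≤ cdf ν y}) ∪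
      ({x | cdf μ x ∈ Ioo (0 : ℝ) 1}ᶜ ∩ {_x | 0 ≤ y}) := by
    ext x
    by_cases hx : cdf μ x ∈ Ioo (0 : ℝ) 1
    · simp only [mem_preimage, mem_Iic, rearrangement_le_iff hx]
      simp [-mem_Ioo, hx]
    · simp only [mem_preimage, mem_Iic, rearrangement, if_neg hx]
      simp [-mem_Ioo, hx]
  rw [this]
  exact (hI.inter (measurableSet_le (cdf μ).mono.measurable measurable_const)).union
    (hI.compl.inter (MeasurableSet.const _))

theorem map_rearrangement [IsProbabilityMeasure μ] [NullSingletonClass μ] [NullSingletonClass ν] :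
    μ.map (rearrangement μ ν) = ν := by
  have : IsProbabilityMeasure (μ.map (rearrangement μ ν)) :=
    Measure.isProbabilityMeasure_map measurable_rearrangement.aemeasurable
  refine Measure.ext_of_Iic _ _ fun y => ?_
  rw [Measure.map_apply measurable_rearrangement measurableSet_Iic, ← ofReal_cdf]
  have h : (rearrangement μ ν ⁻¹' Iic y : Set ℝ) =ᵐ[μ] {x | cdf μ x ≤ cdf ν y} := by
    filter_upwards [ae_cdf_mem_Ioo μ] with x hx
    exact propext (rearrangement_le_iff hx y)
  rw [measure_congr h]
  rcases (cdf_le_one ν y).eq_or_lt with h1 | h1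
  · rw [h1]
    have : {x | cdf μ x ≤ 1} = univ := by ext x; simp [cdf_le_one]
    rw [this]; simp
  · exact measure_cdf_le μ (cdf_nonneg ν y) h1

end

theorem ae_hasDerivAt_cdf {f : ℝ → ℝ≥0∞} (hf : Measurable f) (h1 : ∫⁻ x, f x = 1) :
    ∀ᵐ x, HasDerivAt (cdf (volume.withDensity f)) (f x).toReal x := by
  have hprob : IsProbabilityMeasure (volume.withDensity f) := ⟨by simpa using h1⟩
  have h := (cdf (volume.withDensity f)).ae_hasDerivAt
  rw [measure_cdf] at h
  filter_upwards [h, Measure.rnDeriv_withDensity volume hf] with x hx hx'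
  rwa [hx'] at hx

/-- One-sided change of variables along the displacement interpolation of an increasing
rearrangement. -/
theorem lintegral_rearrangement_le {f q : ℝ → ℝ≥0∞} (hf : Measurable f) (hq : Measurable q)
    (hf1 : ∫⁻ x, f x = 1) (hq1 : ∫⁻ x, q x = 1) {T : ℝ → ℝ}
    (hT : T = rearrangement (volume.withDensity f) (volume.withDensity q)) {E : Set ℝ}
    (hE : E = {x | cdf (volume.withDensity f) x ∈ Ioo (0 : ℝ) 1 ∧ f x ≠ 0 ∧ f x ≠ ∞ ∧
      q (T x) ≠ 0 ∧ q (T x) ≠ ∞}) :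
    (∫⁻ x in Eᶜ, f x = 0) ∧ ∀ t ∈ Icc (0 : ℝ) 1, ∀ g : ℝ → ℝ≥0∞,
      ∫⁻ x in E, g ((1 - t) * x + t * T x) *
        (ENNReal.ofReal (1 - t) + ENNReal.ofReal t * (f x / q (T x))) ≤ ∫⁻ x, g x := by
  set μ := volume.withDensity f with hμ
  set ν := volume.withDensity q with hν
  have hμp : IsProbabilityMeasure μ := ⟨by simpa [hμ] using hf1⟩
  have hνp : IsProbabilityMeasure ν := ⟨by simpa [hν] using hq1⟩
  have hTm : Measurable T := hT ▸ measurable_rearrangement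
  have hmap : μ.map T = ν := hT ▸ map_rearrangement
  have hgoodν : ∀ᵐ y ∂ν, HasDerivAt (cdf ν) (q y).toReal y ∧ q y ≠ 0 ∧ q y ≠ ∞ := by
    rw [hν, ae_withDensity_iff hq]
    filter_upwards [ae_hasDerivAt_cdf hq hq1, ae_lt_top hq (by simp [hq1])] with y h1 h2 h3
    exact ⟨h1, h3, h2.ne⟩
  -- The bad targets `y` are `ν`-null, and `T` carries `μ` to `ν`, so the points sent to them are
  -- `μ`-null.
  have hgood : ∀ᵐ x ∂μ, HasDerivAt (cdf ν) (q (T x)).toReal (T x) ∧ q (T x) ≠ 0 ∧ q (T x) ≠ ∞ := by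
    rw [← hmap] at hgoodν
    have h := ae_of_ae_map hTm.aemeasurable hgoodν
    rwa [hmap] at h
  have hIm : MeasurableSet {x | cdf μ x ∈ Ioo (0 : ℝ) 1} :=
    (cdf μ).mono.measurable measurableSet_Ioo
  have hIo : IsOpen {x | cdf μ x ∈ Ioo (0 : ℝ) 1} := isOpen_Ioo.preimage (continuous_cdf μ)
  have hEm : MeasurableSet E := by
    rw [hE]
    have h1 : MeasurableSet {x | f x ≠ 0} := (measurableSet_eq_fun hf measurable_const).compl
    have h2 : MeasurableSet {x | f x ≠ ∞} := (measurableSet_eq_fun hf measurable_const).compl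
    have h3 : MeasurableSet {x | q (T x) ≠ 0} :=
      (measurableSet_eq_fun (hq.comp hTm) measurable_const).compl
    have h4 : MeasurableSet {x | q (T x) ≠ ∞} :=
      (measurableSet_eq_fun (hq.comp hTm) measurable_const).compl
    exact hIm.inter (h1.inter (h2.inter (h3.inter h4)))
  constructor
  · have hEae : ∀ᵐ x ∂μ, x ∈ E := by
      have hfin : ∀ᵐ x ∂μ, f x ≠ 0 ∧ f x ≠ ∞ := by
        rw [hμ, ae_withDensity_iff hf]
        filter_upwards [ae_lt_top hf (by simp [hf1])] with x h2 h3 using ⟨h3, h2.ne⟩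
      filter_upwards [hgood, hfin, ae_cdf_mem_Ioo μ] with x h1 h2 h3
      rw [hE]
      exact ⟨h3, h2.1, h2.2, h1.2⟩
    rw [← withDensity_apply _ hEm.compl]
    exact hEae
  · intro t ht g
    have hTmono : MonotoneOn T {x | cdf μ x ∈ Ioo (0 : ℝ) 1} := hT ▸ monotoneOn_rearrangement
    -- A monotone map is differentiable almost everywhere, and the chain rule in `cdf ν ∘ T = cdf μ`
    -- forces `q(T) T' = f`.
    have hae : ∀ᵐ x, x ∈ E → HasDerivAt T (f x / q (T x)).toReal x := by
      rw [hμ, ae_withDensity_iff hf] at hgood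
      filter_upwards [hgood, hTmono.ae_differentiableWithinAt_of_mem, ae_hasDerivAt_cdf hf hf1]
        with x h1 h2 h3 hxE
      rw [hE] at hxE
      obtain ⟨hxI, hf0, hft, hq0, hqt⟩ := hxE
      have hnhds : {x | cdf μ x ∈ Ioo (0 : ℝ) 1} ∈ 𝓝 x := hIo.mem_nhds hxI
      have hd := (h2 hxI).differentiableAt hnhds |>.hasDerivAt
      have hcomp := (h1 hf0).1.comp x hd
      have heq : (cdf ν ∘ T) =ᶠ[𝓝 x] cdf μ := by
        filter_upwards [hnhds] with z hz
        simp only [Function.comp_apply, hT]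
        exact cdf_rearrangement hz
      have hu := (hcomp.congr_of_eventuallyEq heq.symm).unique h3
      have hqr : (q (T x)).toReal ≠ 0 := (ENNReal.toReal_pos hq0 hqt).ne'
      rw [ENNReal.toReal_div, ← hu, mul_div_cancel_left₀ _ hqr]
      exact hd
    rw [ae_iff] at hae
    -- The change of variables needs a derivative at every point of a measurable set, so a
    -- measurable null set is removed from `E`.
    set N := toMeasurable volume {x | ¬ (x ∈ E → HasDerivAt T (f x / q (T x)).toReal x)}
    have hN0 : volume N = 0 := (measure_toMeasurable _).trans hae
    have hder : ∀ x ∈ E \ N, HasDerivAt T (f x / q (T x)).toReal x := by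
      intro x hx
      by_contra hcon
      exact hx.2 (subset_toMeasurable _ _ fun h => hcon (h hx.1))
    have hset : (E \ N : Set ℝ) =ᵐ[volume] E := sdiff_null_ae_eq_self hN0
    rw [← setLIntegral_congr hset]
    have hmono : MonotoneOn (fun x => (1 - t) * x + t * T x) (E \ N) := by
      intro x hx y hy hxy
      have hx' := hx.1
      have hy' := hy.1
      rw [hE] at hx' hy'
      exact add_le_add (mul_le_mul_of_nonneg_left hxy (by linarith [ht.2]))
        (mul_le_mul_of_nonneg_left (hTmono hx'.1 hy'.1 hxy) ht.1)
    have hcv := lintegral_image_eq_lintegral_deriv_mul_of_monotoneOn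
      (hEm.diff (measurableSet_toMeasurable _ _))
      (f' := fun x => (1 - t) * 1 + t * (f x / q (T x)).toReal)
      (fun x hx => (((hasDerivAt_id x).const_mul (1 - t)).add
        ((hder x hx).const_mul t)).hasDerivWithinAt) hmono g
    -- Only an inequality survives here, since the image of `E \ N` need not fill the line; the
    -- entropy argument needs no more.
    refine le_trans (le_of_eq ?_) (hcv.symm.le.trans (setLIntegral_le_lintegral _ _))
    refine setLIntegral_congr_fun (hEm.diff (measurableSet_toMeasurable _ _)) fun x hx => ?_
    have hx' := hx.1
    rw [hE] at hx'
    simp only [Pi.add_apply, id]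
    rw [mul_comm, mul_one, ENNReal.ofReal_add (by linarith [ht.2])
      (mul_nonneg ht.1 ENNReal.toReal_nonneg), ENNReal.ofReal_mul ht.1,
      ENNReal.ofReal_toReal (ENNReal.div_ne_top hx'.2.2.1 hx'.2.2.2.1)]

end Line

/-! ### The Knothe map -/

section Knothe

open Set Function

theorem cdf_withDensity {f : ℝ → ℝ≥0∞} (h1 : ∫⁻ x, f x = 1) (x : ℝ) :
    cdf (volume.withDensity f) x = (∫⁻ z in Iic x, f z).toReal := by
  have : IsProbabilityMeasure (volume.withDensity f) := ⟨by simpa using h1⟩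
  rw [cdf_eq_real, measureReal_def, withDensity_apply _ measurableSet_Iic]

theorem measurable_setLIntegral_Iic {Ω : Type*} [MeasurableSpace Ω] {f : Ω → ℝ → ℝ≥0∞}
    (hf : Measurable (uncurry f)) :
    Measurable fun q : Ω × ℝ => ∫⁻ z in Iic q.2, f q.1 z := by
  have h : ∀ q : Ω × ℝ, ∫⁻ z in Iic q.2, f q.1 z = ∫⁻ z, if z ≤ q.2 then f q.1 z else 0 := by
    intro q
    rw [← lintegral_indicator measurableSet_Iic]
    rfl
  simp only [h]
  refine Measurable.lintegral_prod_right'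
    (f := fun r : (Ω × ℝ) × ℝ => if r.2 ≤ r.1.2 then f r.1.1 r.2 else 0) ?_
  refine Measurable.ite (measurableSet_le measurable_snd (measurable_snd.comp measurable_fst)) ?_
    measurable_const
  exact hf.comp ((measurable_fst.comp measurable_fst).prodMk measurable_snd)

/-- A measurable family of increasing rearrangements. -/
theorem exists_rearrangement_family {Ω : Type*} [MeasurableSpace Ω] {ρ p : Ω → ℝ → ℝ≥0∞}
    (hρ : Measurable (uncurry ρ)) (hp : Measurable (uncurry p)) :
    ∃ (T : Ω → ℝ → ℝ) (E : Set (Ω × ℝ)), Measurable (uncurry T) ∧ MeasurableSet E ∧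
      ∀ ω, ∫⁻ x, ρ ω x = 1 → ∫⁻ x, p ω x = 1 →
        (∫⁻ x in {x | (ω, x) ∈ E}ᶜ, ρ ω x = 0) ∧
        (∀ x, (ω, x) ∈ E → ρ ω x ≠ 0 ∧ ρ ω x ≠ ∞ ∧ p ω (T ω x) ≠ 0 ∧ p ω (T ω x) ≠ ∞) ∧
        ∀ t ∈ Icc (0 : ℝ) 1, ∀ g : ℝ → ℝ≥0∞,
          ∫⁻ x in {x | (ω, x) ∈ E}, g ((1 - t) * x + t * T ω x) *
            (ENNReal.ofReal (1 - t) + ENNReal.ofReal t * (ρ ω x / p ω (T ω x)))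
            ≤ ∫⁻ x, g x := by
  classical
  let F : Ω × ℝ → ℝ := fun q => (∫⁻ z in Iic q.2, ρ q.1 z).toReal
  let G : Ω × ℝ → ℝ := fun q => (∫⁻ z in Iic q.2, p q.1 z).toReal
  have hF : Measurable F := (measurable_setLIntegral_Iic hρ).ennreal_toReal
  have hG : Measurable G := (measurable_setLIntegral_Iic hp).ennreal_toReal
  let B : Set Ω := {ω | ∫⁻ x, ρ ω x = 1 ∧ ∫⁻ x, p ω x = 1}
  have hB : MeasurableSet B :=
    (measurableSet_eq_fun (Measurable.lintegral_prod_right' hρ) measurable_const).inter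
      (measurableSet_eq_fun (Measurable.lintegral_prod_right' hp) measurable_const)
  let D : Set (Ω × ℝ) := {q | q.1 ∈ B ∧ F q ∈ Ioo (0 : ℝ) 1}
  have hD : MeasurableSet D := (measurable_fst hB).inter (hF measurableSet_Ioo)
  -- The default 0 agrees with that of `rearrangement`, so for normalized `ω` the two maps coincide
  -- everywhere, while `T` is jointly measurable through its sublevel sets.
  let T : Ω → ℝ → ℝ := fun ω x => if (ω, x) ∈ D then
    rearrangement (volume.withDensity (ρ ω)) (volume.withDensity (p ω)) x else 0
  have hcF : ∀ {ω}, ω ∈ B → ∀ x, cdf (volume.withDensity (ρ ω)) x = F (ω, x) :=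
    fun h x => cdf_withDensity h.1 x
  have hcG : ∀ {ω}, ω ∈ B → ∀ x, cdf (volume.withDensity (p ω)) x = G (ω, x) :=
    fun h x => cdf_withDensity h.2 x
  have hTm : Measurable (uncurry T) := by
    refine measurable_of_Iic fun y => ?_
    have : uncurry T ⁻¹' Iic y = (D ∩ {q | F q ≤ G (q.1, y)}) ∪ (Dᶜ ∩ {_q | 0 ≤ y}) := by
      ext ⟨ω, x⟩
      by_cases hx : (ω, x) ∈ D
      · have hω : ω ∈ B := hx.1
        have : IsProbabilityMeasure (volume.withDensity (p ω)) := ⟨by simpa using hω.2⟩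
        have hc : cdf (volume.withDensity (ρ ω)) x ∈ Ioo (0 : ℝ) 1 := by
          rw [hcF hω]; exact hx.2
        have h := rearrangement_le_iff (ν := volume.withDensity (p ω)) hc y
        rw [hcF hω, hcG hω] at h
        simp [T, hx, h]
      · simp [T, hx]
    rw [this]
    exact (hD.inter (measurableSet_le hF (hG.comp (measurable_fst.prodMk measurable_const)))).union
      (hD.compl.inter (MeasurableSet.const _))
  have hpT : Measurable fun q : Ω × ℝ => p q.1 (T q.1 q.2) :=
    hp.comp (measurable_fst.prodMk hTm)
  let E : Set (Ω × ℝ) := {q | q ∈ D ∧ ρ q.1 q.2 ≠ 0 ∧ ρ q.1 q.2 ≠ ∞ ∧ p q.1 (T q.1 q.2) ≠ 0 ∧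
    p q.1 (T q.1 q.2) ≠ ∞}
  have hEm : MeasurableSet E := by
    have h1 : MeasurableSet {q : Ω × ℝ | ρ q.1 q.2 ≠ 0} :=
      (measurableSet_eq_fun hρ measurable_const).compl
    have h2 : MeasurableSet {q : Ω × ℝ | ρ q.1 q.2 ≠ ∞} :=
      (measurableSet_eq_fun hρ measurable_const).compl
    have h3 : MeasurableSet {q : Ω × ℝ | p q.1 (T q.1 q.2) ≠ 0} :=
      (measurableSet_eq_fun hpT measurable_const).compl
    have h4 : MeasurableSet {q : Ω × ℝ | p q.1 (T q.1 q.2) ≠ ∞} :=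
      (measurableSet_eq_fun hpT measurable_const).compl
    exact hD.inter (h1.inter (h2.inter (h3.inter h4)))
  refine ⟨T, E, hTm, hEm, fun ω h1 h2 => ?_⟩
  have hω : ω ∈ B := ⟨h1, h2⟩
  have hTω : T ω = rearrangement (volume.withDensity (ρ ω)) (volume.withDensity (p ω)) := by
    funext x
    by_cases hx : (ω, x) ∈ D
    · simp [T, hx]
    · have hc : cdf (volume.withDensity (ρ ω)) x ∉ Ioo (0 : ℝ) 1 := by
        rw [hcF hω]; exact fun h => hx ⟨hω, h⟩
      simp only [T, hx, if_false, rearrangement, if_neg hc]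
  have hEω : {x | (ω, x) ∈ E} = {x | cdf (volume.withDensity (ρ ω)) x ∈ Ioo (0 : ℝ) 1 ∧
      ρ ω x ≠ 0 ∧ ρ ω x ≠ ∞ ∧ p ω (T ω x) ≠ 0 ∧ p ω (T ω x) ≠ ∞} := by
    ext x
    simp only [mem_ofPred_eq, hcF hω]
    exact ⟨fun h => ⟨h.1.2, h.2⟩, fun h => ⟨⟨hω, h.1⟩, h.2⟩⟩
  have key := lintegral_rearrangement_le (hρ.comp measurable_prodMk_left)
    (hp.comp measurable_prodMk_left) h1 h2 hTω hEω
  exact ⟨key.1, fun x hx => hx.2, key.2⟩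

theorem measurable_finCons {n : ℕ} :
    Measurable fun q : ℝ × (Fin n → ℝ) => (Fin.cons q.1 q.2 : Fin (n + 1) → ℝ) := by
  refine measurable_pi_lambda _ fun i => ?_
  refine Fin.cases ?_ (fun j => ?_) i
  · exact measurable_fst
  · exact (measurable_pi_apply j).comp measurable_snd

theorem lintegral_finCons {n : ℕ} {h : (Fin (n + 1) → ℝ) → ℝ≥0∞} (hh : Measurable h) :
    ∫⁻ x, h x = ∫⁻ a : ℝ, ∫⁻ x : Fin n → ℝ, h (Fin.cons a x) := by
  have e := (volume_preserving_piFinSuccAbove (fun _ : Fin (n + 1) => ℝ) 0).symm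
  rw [← e.lintegral_comp hh, Measure.volume_eq_prod, lintegral_prod]
  · simp [MeasurableEquiv.piFinSuccAbove, Fin.insertNthEquiv]
  · exact (hh.comp e.measurable).aemeasurable

/-- A measurable family of Knothe maps `T` between probability densities `ρ` and `p` on `ℝ^n`, with
diagonal derivatives `J`, and the one-sided change of variables along coordinatewise
interpolations between the identity and `T`. -/
theorem exists_knothe_family (n : ℕ) : ∀ {Ω : Type} [MeasurableSpace Ω]
    {ρ p : Ω → (Fin n → ℝ) → ℝ≥0∞}, Measurable (uncurry ρ) → Measurable (uncurry p) →
    ∃ (T : Ω → (Fin n → ℝ) → Fin n → ℝ) (J : Ω → (Fin n → ℝ) → Fin n → ℝ≥0∞)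
      (E : Set (Ω × (Fin n → ℝ))),
      Measurable (uncurry T) ∧ Measurable (uncurry J) ∧ MeasurableSet E ∧
      ∀ ω, ∫⁻ x, ρ ω x = 1 → ∫⁻ x, p ω x = 1 →
        (∫⁻ x in {x | (ω, x) ∈ E}ᶜ, ρ ω x = 0) ∧
        (∀ x, (ω, x) ∈ E → ρ ω x = p ω (T ω x) * ∏ i, J ω x i ∧
          ∀ i, J ω x i ≠ 0 ∧ J ω x i ≠ ∞) ∧
        ∀ t : Fin n → ℝ, (∀ i, t i ∈ Icc (0 : ℝ) 1) → ∀ g : (Fin n → ℝ) → ℝ≥0∞, Measurable g →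
          ∫⁻ x in {x | (ω, x) ∈ E}, g (fun i => (1 - t i) * x i + t i * T ω x i) *
            ∏ i, (ENNReal.ofReal (1 - t i) + ENNReal.ofReal (t i) * J ω x i)
            ≤ ∫⁻ x, g x := by
  induction n with
  | zero =>
    intro Ω _ ρ p hρ hp
    refine ⟨fun _ x => x, fun _ _ _ => 1, univ, measurable_snd, measurable_const,
      MeasurableSet.univ, fun ω h1 h2 => ⟨by simp, fun x _ => ⟨?_, fun i => i.elim0⟩, ?_⟩⟩
    · rw [lintegral_unique] at h1 h2
      simp only [volume_pi, Measure.pi_univ, Finset.univ_eq_empty, Finset.prod_empty, mul_one]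
        at h1 h2 ⊢
      exact (congrArg (ρ ω) (Subsingleton.elim _ _)).trans
        (h1.trans (h2.symm.trans (congrArg (p ω) (Subsingleton.elim _ _))))
    · intro t _ g _
      refine (setLIntegral_le_lintegral _ _).trans (lintegral_mono fun x => ?_)
      simp only [Finset.univ_eq_empty, Finset.prod_empty, mul_one]
      exact le_of_eq (congrArg g (Subsingleton.elim _ _))
  | succ n ih =>
    intro Ω _ ρ p hρ hp
    let ρ0 : Ω → ℝ → ℝ≥0∞ := fun ω a => ∫⁻ x : Fin n → ℝ, ρ ω (Fin.cons a x)
    let p0 : Ω → ℝ → ℝ≥0∞ := fun ω a => ∫⁻ x : Fin n → ℝ, p ω (Fin.cons a x)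
    have hcons : ∀ {f : Ω → (Fin (n + 1) → ℝ) → ℝ≥0∞}, Measurable (uncurry f) →
        Measurable fun r : (Ω × ℝ) × (Fin n → ℝ) => f r.1.1 (Fin.cons r.1.2 r.2) := by
      intro f hf
      exact hf.comp ((measurable_fst.comp measurable_fst).prodMk (measurable_finCons.comp
        ((measurable_snd.comp measurable_fst).prodMk measurable_snd)))
    have hρ0 : Measurable (uncurry ρ0) := Measurable.lintegral_prod_right' (hcons hρ)
    have hp0 : Measurable (uncurry p0) := Measurable.lintegral_prod_right' (hcons hp)
    obtain ⟨T0, E0, hT0, hE0, h0⟩ := exists_rearrangement_family hρ0 hp0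
    -- Conditional densities given the first coordinate, on the target side given its image under
    -- `T0`. The first coordinate becomes part of the parameter, which is why the induction runs
    -- over all measurable families.
    let ρ' : Ω × ℝ → (Fin n → ℝ) → ℝ≥0∞ := fun q x => ρ q.1 (Fin.cons q.2 x) / ρ0 q.1 q.2
    let p' : Ω × ℝ → (Fin n → ℝ) → ℝ≥0∞ := fun q x =>
      p q.1 (Fin.cons (T0 q.1 q.2) x) / p0 q.1 (T0 q.1 q.2)
    have hT0' : Measurable fun q : Ω × ℝ => (q.1, T0 q.1 q.2) := measurable_fst.prodMk hT0
    have hρ' : Measurable (uncurry ρ') := (hcons hρ).div (hρ0.comp measurable_fst)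
    have hp' : Measurable (uncurry p') :=
      ((hcons hp).comp ((hT0'.comp measurable_fst).prodMk measurable_snd)).div
        ((hp0.comp hT0').comp measurable_fst)
    obtain ⟨T', J', E', hT', hJ', hE', h'⟩ := ih hρ' hp'
    let s : Ω × (Fin (n + 1) → ℝ) → (Ω × ℝ) × (Fin n → ℝ) := fun q => ((q.1, q.2 0), Fin.tail q.2)
    have hs : Measurable s := by
      refine (measurable_fst.prodMk ((measurable_pi_apply 0).comp measurable_snd)).prodMk ?_
      exact measurable_pi_lambda _ fun i => (measurable_pi_apply i.succ).comp measurable_snd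
    let T : Ω → (Fin (n + 1) → ℝ) → Fin (n + 1) → ℝ := fun ω x =>
      Fin.cons (T0 ω (x 0)) (T' (ω, x 0) (Fin.tail x))
    let J0 : Ω → ℝ → ℝ≥0∞ := fun ω a => ρ0 ω a / p0 ω (T0 ω a)
    have hJ0 : Measurable (uncurry J0) := hρ0.div (hp0.comp hT0')
    let J : Ω → (Fin (n + 1) → ℝ) → Fin (n + 1) → ℝ≥0∞ := fun ω x =>
      Fin.cons (J0 ω (x 0)) (J' (ω, x 0) (Fin.tail x))
    let E : Set (Ω × (Fin (n + 1) → ℝ)) := {q | (q.1, q.2 0) ∈ E0 ∧ s q ∈ E'}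
    have hEm : MeasurableSet E := ((measurable_fst.comp hs) hE0).inter (hs hE')
    have hTm : Measurable (uncurry T) := measurable_finCons.comp
      ((hT0.comp (measurable_fst.comp hs)).prodMk (hT'.comp hs))
    have hJm : Measurable (uncurry J) := by
      refine measurable_pi_lambda _ fun i => ?_
      refine Fin.cases ?_ (fun j => ?_) i
      · exact hJ0.comp (measurable_fst.comp hs)
      · exact (measurable_pi_apply j).comp (hJ'.comp hs)
    refine ⟨T, J, E, hTm, hJm, hEm, fun ω h1 h2 => ?_⟩
    have hsec : MeasurableSet {x | (ω, x) ∈ E} := measurable_prodMk_left hEm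
    have hsec0 : MeasurableSet {a | (ω, a) ∈ E0} := measurable_prodMk_left hE0
    have hsec' : ∀ a, MeasurableSet {x | ((ω, a), x) ∈ E'} := fun a => measurable_prodMk_left hE'
    have hρω : Measurable (ρ ω) := hρ.comp measurable_prodMk_left
    have hpω : Measurable (p ω) := hp.comp measurable_prodMk_left
    have h10 : ∫⁻ a, ρ0 ω a = 1 := by rw [← h1, lintegral_finCons hρω]
    have h20 : ∫⁻ a, p0 ω a = 1 := by rw [← h2, lintegral_finCons hpω]
    obtain ⟨h0a, h0b, h0c⟩ := h0 ω h10 h20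
    have hn : ∀ a, (ω, a) ∈ E0 → ∫⁻ x, ρ' (ω, a) x = 1 ∧ ∫⁻ x, p' (ω, a) x = 1 := by
      intro a ha
      obtain ⟨b1, b2, b3, b4⟩ := h0b a ha
      constructor
      · change ∫⁻ x, ρ ω (Fin.cons a x) / ρ0 ω a = 1
        simp only [div_eq_mul_inv]
        rw [lintegral_mul_const' _ _ (ENNReal.inv_ne_top.2 b1)]
        exact ENNReal.mul_inv_cancel b1 b2
      · change ∫⁻ x, p ω (Fin.cons (T0 ω a) x) / p0 ω (T0 ω a) = 1
        simp only [div_eq_mul_inv]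
        rw [lintegral_mul_const' _ _ (ENNReal.inv_ne_top.2 b3)]
        exact ENNReal.mul_inv_cancel b3 b4
    refine ⟨?_, ?_, ?_⟩
    · rw [← lintegral_indicator hsec.compl, lintegral_finCons (hρω.indicator hsec.compl)]
      -- Over `E0` the inductive hypothesis kills the slice; elsewhere it is bounded by the
      -- marginal, whose integral off `E0` is zero.
      have hle : ∀ a, ∫⁻ x : Fin n → ℝ, ({x | (ω, x) ∈ E}ᶜ).indicator (ρ ω) (Fin.cons a x)
          ≤ ({a | (ω, a) ∈ E0}ᶜ).indicator (ρ0 ω) a := by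
        intro a
        by_cases ha : (ω, a) ∈ E0
        · have hz := (h' (ω, a) (hn a ha).1 (hn a ha).2).1
          obtain ⟨b1, b2, b3, b4⟩ := h0b a ha
          rw [← lintegral_indicator (hsec' a).compl] at hz
          have : ∫⁻ x : Fin n → ℝ, ({x | (ω, x) ∈ E}ᶜ).indicator (ρ ω) (Fin.cons a x)
              = (∫⁻ x, ({x | ((ω, a), x) ∈ E'}ᶜ).indicator (ρ' (ω, a)) x) * ρ0 ω a := by
            rw [← lintegral_mul_const' _ _ b2]
            refine lintegral_congr fun x => ?_
            by_cases hx : ((ω, a), x) ∈ E'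
            · simp [E, s, ha, hx]
            · simp [E, s, ha, hx, ρ', ENNReal.div_mul_cancel b1 b2]
          rw [this, hz, zero_mul]
          exact zero_le
        · rw [indicator_of_mem (by exact ha)]
          exact lintegral_mono fun x => indicator_le_self _ _ _
      refine le_antisymm ((lintegral_mono hle).trans ?_) zero_le
      rw [lintegral_indicator hsec0.compl, h0a]
    · intro x hx
      obtain ⟨ha, hx'⟩ := hx
      obtain ⟨b1, b2, b3, b4⟩ := h0b _ ha
      obtain ⟨hJac, hJne⟩ := (h' _ (hn _ ha).1 (hn _ ha).2).2.1 _ hx'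
      constructor
      · simp only [ρ', p', Fin.cons_self_tail] at hJac
        rw [Fin.prod_univ_succ]
        change ρ ω x = p ω (Fin.cons (T0 ω (x 0)) (T' (ω, x 0) (Fin.tail x))) *
          (ρ0 ω (x 0) / p0 ω (T0 ω (x 0)) * ∏ i, J' (ω, x 0) (Fin.tail x) i)
        have e1 : ρ ω x = ρ ω x / ρ0 ω (x 0) * ρ0 ω (x 0) := (ENNReal.div_mul_cancel b1 b2).symm
        rw [e1, hJac]
        simp only [div_eq_mul_inv]
        ring
      · intro i
        refine Fin.cases ?_ (fun j => ?_) i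
        · exact ⟨ENNReal.div_ne_zero.2 ⟨b1, b4⟩, ENNReal.div_ne_top b2 b3⟩
        · exact hJne j
    · intro t ht g hg
      let w : (Fin (n + 1) → ℝ) → ℝ≥0∞ := fun x =>
        g (fun i => (1 - t i) * x i + t i * T ω x i) *
            ∏ i, (ENNReal.ofReal (1 - t i) + ENNReal.ofReal (t i) * J ω x i)
      have hTω : Measurable (T ω) := hTm.comp measurable_prodMk_left
      have hJω : Measurable (J ω) := hJm.comp measurable_prodMk_left
      have hw : Measurable w := by
        refine (hg.comp (measurable_pi_lambda _ fun i => ?_)).mul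
          (Finset.measurable_prod _ fun i _ => ?_)
        · exact ((measurable_pi_apply i).const_mul _).add
            (((measurable_pi_apply i).comp hTω).const_mul _)
        · exact (((measurable_pi_apply i).comp hJω).const_mul _).const_add _
      change ∫⁻ x in {x | (ω, x) ∈ E}, w x ≤ _
      rw [← lintegral_indicator hsec, lintegral_finCons (hw.indicator hsec), lintegral_finCons hg]
      -- The first interpolated coordinate depends on `a` alone, so the inductive inequality applies
      -- on each slice and the one-dimensional one then applies to the slice integrals `G`.
      let G : ℝ → ℝ≥0∞ := fun b => ∫⁻ y : Fin n → ℝ, g (Fin.cons b y)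
      refine le_trans ?_ (h0c (t 0) (ht 0) G)
      rw [← lintegral_indicator hsec0]
      refine lintegral_mono fun a => ?_
      by_cases ha : (ω, a) ∈ E0
      · rw [indicator_of_mem (by exact ha)]
        set c := (1 - t 0) * a + t 0 * T0 ω a with hc
        set j := ENNReal.ofReal (1 - t 0) + ENNReal.ofReal (t 0) * (ρ0 ω a / p0 ω (T0 ω a)) with hj
        have hgc : Measurable fun y : Fin n → ℝ => g (Fin.cons c y) :=
          hg.comp (measurable_finCons.comp measurable_prodMk_left)
        have h3 := (h' _ (hn _ ha).1 (hn _ ha).2).2.2 (fun i => t i.succ) (fun i => ht _) _ hgc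
        rw [← lintegral_indicator (hsec' a)] at h3
        obtain ⟨b1, b2, b3, b4⟩ := h0b _ ha
        have hjt : j ≠ ∞ := by
          refine ENNReal.add_ne_top.2 ⟨ENNReal.ofReal_ne_top, ENNReal.mul_ne_top
            ENNReal.ofReal_ne_top (ENNReal.div_ne_top b2 b3)⟩
        refine le_trans (le_of_eq ?_) (mul_le_mul_left h3 j)
        rw [← lintegral_mul_const' _ _ hjt]
        refine lintegral_congr fun x => ?_
        by_cases hx : ((ω, a), x) ∈ E'
        · rw [indicator_of_mem (by simpa [E, s] using ⟨ha, hx⟩), indicator_of_mem (by exact hx)]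
          simp only [w, Fin.prod_univ_succ]
          have e : (fun i => (1 - t i) * (Fin.cons a x : Fin (n + 1) → ℝ) i
              + t i * T ω (Fin.cons a x) i) = Fin.cons c (fun i : Fin n =>
                (1 - t i.succ) * x i + t i.succ * T' (ω, a) x i) := by
            funext i
            refine Fin.cases ?_ (fun k => ?_) i
            · simp [T, hc]
            · simp [T]
          rw [e]
          simp only [J, Fin.cons_zero, Fin.cons_succ, Fin.tail_cons, J0]
          rw [← hj]
          ring
        · rw [indicator_of_notMem (by simpa [E, s] using fun _ => hx),
            indicator_of_notMem (by exact hx), zero_mul]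
      · rw [indicator_of_notMem (by exact ha)]
        refine le_of_eq ?_
        rw [← lintegral_zero]
        refine lintegral_congr fun x => ?_
        rw [indicator_of_notMem (by simpa [E] using fun h => absurd h ha)]

end Knothe

/-! ### Entropy inequality along the interpolated Knothe map -/

section Entropy

open Set Function

theorem mul_log_le_log_interpolation {t c : ℝ} (ht : t ∈ Icc (0 : ℝ) 1) (hc : 0 < c) :
    t * Real.log c ≤ Real.log ((1 - t) + t * c) := by
  have h := strictConcaveOn_log_Ioi.concaveOn.2 (mem_Ioi.2 zero_lt_one) (mem_Ioi.2 hc)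
    (sub_nonneg.2 ht.2) ht.1 (by ring)
  simpa using h

theorem sum_mul_ite_mem {N d ℓ : ℕ} {S : Fin N → Finset (Fin d)}
    (hS : ∀ i, (Finset.univ.filter fun j => i ∈ S j).card = ℓ) (a : Fin d → ℝ) :
    ∑ j, ∑ i, (if i ∈ S j then a i else 0) = ℓ * ∑ i, a i := by
  rw [Finset.sum_comm, Finset.mul_sum]
  refine Finset.sum_congr rfl fun i _ => ?_
  rw [← Finset.sum_filter, Finset.sum_const, hS, nsmul_eq_mul]

/-- The transport core in coordinates. Convexity and smoothness enter only through `hconv`, which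
compares the partial moves of the potential with the full move. -/
theorem sum_integral_le_of_interpolation {d N ℓ : ℕ} {S : Fin N → Finset (Fin d)}
    (hS : ∀ i, (Finset.univ.filter fun j => i ∈ S j).card = ℓ)
    {V : (Fin d → ℝ) → ℝ} (hV : Measurable V) {r : (Fin d → ℝ) → ℝ≥0∞} (hr : Measurable r)
    (hp1 : ∫⁻ x, ENNReal.ofReal (Real.exp (-V x)) = 1)
    (hr1 : ∫⁻ x, r x * ENNReal.ofReal (Real.exp (-V x)) = 1)
    {t : ℝ} (ht : t ∈ Icc (0 : ℝ) 1)
    (hconv : ∀ x y : Fin d → ℝ,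
      ∑ j, (V (fun i => if i ∈ S j then (1 - t) * x i + t * y i else x i) - V x)
        ≤ t * ℓ * (V y - V x))
    {g : Fin N → (Fin d → ℝ) → ℝ} (hg : ∀ j, Measurable (g j))
    (hginv : ∀ j x y, (∀ i ∉ S j, x i = y i) → g j x = g j y)
    (hg1 : ∀ j, ∫⁻ x, ENNReal.ofReal (Real.exp (g j x)) * ENNReal.ofReal (Real.exp (-V x)) ≤ 1)
    {μ : Measure (Fin d → ℝ)}
    (hμ : μ = volume.withDensity fun x => r x * ENNReal.ofReal (Real.exp (-V x)))
    (hgi : ∀ j, Integrable (g j) μ) (hri : Integrable (fun x => Real.log (r x).toReal) μ) :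
    ∑ j, ∫ x, g j x ∂μ ≤ (N - t * ℓ) * ∫ x, Real.log (r x).toReal ∂μ := by
  let p : (Fin d → ℝ) → ℝ≥0∞ := fun x => ENNReal.ofReal (Real.exp (-V x))
  let ρ : (Fin d → ℝ) → ℝ≥0∞ := fun x => r x * p x
  have hpm : Measurable p := hV.neg.exp.ennreal_ofReal
  have hρm : Measurable ρ := hr.mul hpm
  have hp0 : ∀ x, p x ≠ 0 := fun x => (ENNReal.ofReal_pos.2 (Real.exp_pos _)).ne'
  have hpt : ∀ x, p x ≠ ∞ := fun x => ENNReal.ofReal_ne_top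
  have hprob : IsProbabilityMeasure μ := ⟨by rw [hμ]; simpa using hr1⟩
  obtain ⟨T, J, E, hT, hJ, hE, hK⟩ := exists_knothe_family d (Ω := Unit) (ρ := fun _ => ρ)
    (p := fun _ => p) (hρm.comp measurable_snd) (hpm.comp measurable_snd)
  obtain ⟨hK1, hK2, hK3⟩ := hK () hr1 hp1
  replace hT : Measurable (T ()) := hT.comp measurable_prodMk_left
  replace hJ : Measurable (J ()) := hJ.comp measurable_prodMk_left
  replace hE : MeasurableSet {x | ((), x) ∈ E} := measurable_prodMk_left hE
  generalize T () = T at *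
  generalize J () = J at *
  replace hK2 : ∀ x ∈ {x | ((), x) ∈ E}, _ := hK2
  generalize {x | ((), x) ∈ E} = E at *
  let τ : Fin N → Fin d → ℝ := fun j i => if i ∈ S j then t else 0
  have hτ : ∀ j i, τ j i ∈ Icc (0 : ℝ) 1 := by
    intro j i
    by_cases h : i ∈ S j <;> simp [τ, h, ht.1, ht.2]
  let Φ : Fin N → (Fin d → ℝ) → Fin d → ℝ := fun j x i => (1 - τ j i) * x i + τ j i * T x i
  have hΦ : ∀ j x, Φ j x = fun i => if i ∈ S j then (1 - t) * x i + t * T x i else x i := by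
    intro j x
    funext i
    by_cases h : i ∈ S j <;> simp [Φ, τ, h]
  have hΦm : ∀ j, Measurable (Φ j) := fun j => measurable_pi_lambda _ fun i =>
    ((measurable_pi_apply i).const_mul _).add (((measurable_pi_apply i).comp hT).const_mul _)
  let D : Fin N → (Fin d → ℝ) → ℝ≥0∞ := fun j x =>
    ∏ i, (ENNReal.ofReal (1 - τ j i) + ENNReal.ofReal (τ j i) * J x i)
  have hDm : ∀ j, Measurable (D j) := fun j => Finset.measurable_prod _ fun i _ =>
    (((measurable_pi_apply i).comp hJ).const_mul _).const_add _
  let q : Fin N → (Fin d → ℝ) → ℝ≥0∞ := fun j x => ENNReal.ofReal (Real.exp (g j x)) * p x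
  have hqm : ∀ j, Measurable (q j) := fun j => (hg j).exp.ennreal_ofReal.mul hpm
  -- The density `q j` pulled back along `Φ j`, relative to `ρ`; the one-sided change of variables
  -- says that its `μ`-mean is at most 1.
  let B : Fin N → (Fin d → ℝ) → ℝ≥0∞ := fun j => E.indicator fun x => q j (Φ j x) * D j x / ρ x
  have hBm : ∀ j, Measurable (B j) := fun j =>
    ((((hqm j).comp (hΦm j)).mul (hDm j)).div hρm).indicator hE
  have hB1 : ∀ j, ∫⁻ x, B j x ∂μ ≤ 1 := by
    intro j
    rw [hμ, lintegral_withDensity_eq_lintegral_mul _ hρm (hBm j)]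
    refine le_trans ?_ ((hK3 (τ j) (hτ j) (q j) (hqm j)).trans (hg1 j))
    rw [← lintegral_indicator hE]
    refine lintegral_mono fun x => ?_
    by_cases hx : x ∈ E
    · simp only [Pi.mul_apply, B, indicator_of_mem hx]
      exact ENNReal.mul_div_le
    · simp [B, hx]
  have hEae : ∀ᵐ x ∂μ, x ∈ E := by
    rw [← withDensity_apply _ hE.compl] at hK1
    rw [hμ]
    exact hK1
  have hBi : ∀ j, Integrable (fun x => (B j x).toReal) μ := fun j =>
    integrable_toReal_of_lintegral_ne_top (hBm j).aemeasurable
      ((hB1 j).trans_lt ENNReal.one_lt_top).ne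
  have hBint : ∀ j, ∫ x, (B j x).toReal ∂μ ≤ 1 := by
    intro j
    rw [integral_toReal (hBm j).aemeasurable (ae_lt_top (hBm j)
      ((hB1 j).trans_lt ENNReal.one_lt_top).ne)]
    exact ENNReal.toReal_le_of_le_ofReal zero_le_one (by simpa using hB1 j)
  have hpoint : ∀ x ∈ E, ∑ j, g j x - (N - t * ℓ) * Real.log (r x).toReal
      ≤ ∑ j, ((B j x).toReal - 1) := by
    intro x hx
    obtain ⟨hjac, hJne⟩ := hK2 x hx
    let K : Fin d → ℝ := fun i => (J x i).toReal
    have hK0 : ∀ i, 0 < K i := fun i => ENNReal.toReal_pos (hJne i).1 (hJne i).2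
    have hρ0 : ρ x ≠ 0 := by
      rw [hjac]
      exact mul_ne_zero (hp0 _) (Finset.prod_ne_zero_iff.2 fun i _ => (hJne i).1)
    have hρt : ρ x ≠ ∞ := by
      rw [hjac]
      exact ENNReal.mul_ne_top (hpt _) (ENNReal.prod_ne_top fun i _ => (hJne i).2)
    have hr0 : r x ≠ 0 := left_ne_zero_of_mul hρ0
    have hρpos : 0 < (ρ x).toReal := ENNReal.toReal_pos hρ0 hρt
    have hrt : r x ≠ ∞ := fun h => hρt (by simp only [ρ, h]; exact ENNReal.top_mul (hp0 x))
    have hrpos : 0 < (r x).toReal := ENNReal.toReal_pos hr0 hrt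
    have hpr : ∀ y, (p y).toReal = Real.exp (-V y) := fun y =>
      ENNReal.toReal_ofReal (Real.exp_pos _).le
    have hlogρ : Real.log (ρ x).toReal = Real.log (r x).toReal - V x := by
      rw [ENNReal.toReal_mul, Real.log_mul hrpos.ne' (by rw [hpr]; exact (Real.exp_pos _).ne'), hpr,
        Real.log_exp]
      ring
    have hlogJ : Real.log (r x).toReal - V x = -V (T x) + ∑ i, Real.log (K i) := by
      rw [← hlogρ, hjac, ENNReal.toReal_mul, ENNReal.toReal_prod, Real.log_mul
        (by rw [hpr]; exact (Real.exp_pos _).ne')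
        (Finset.prod_ne_zero_iff.2 fun i _ => (hK0 i).ne'), hpr, Real.log_exp,
        Real.log_prod fun i _ => (hK0 i).ne']
    let F : Fin N → Fin d → ℝ := fun j i => (1 - τ j i) + τ j i * K i
    have hF0 : ∀ j i, 0 < F j i := by
      intro j i
      rcases (hτ j i).1.eq_or_lt with h | h
      · simp [F, ← h]
      · exact add_pos_of_nonneg_of_pos (sub_nonneg.2 (hτ j i).2) (mul_pos h (hK0 i))
    have hD : ∀ j, (D j x).toReal = ∏ i, F j i := by
      intro j
      rw [ENNReal.toReal_prod]
      refine Finset.prod_congr rfl fun i _ => ?_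
      rw [ENNReal.toReal_add ENNReal.ofReal_ne_top
        (ENNReal.mul_ne_top ENNReal.ofReal_ne_top (hJne i).2), ENNReal.toReal_mul,
        ENNReal.toReal_ofReal (hτ j i).1, ENNReal.toReal_ofReal (sub_nonneg.2 (hτ j i).2)]
    have hgΦ : ∀ j, g j (Φ j x) = g j x := by
      intro j
      refine hginv j _ _ fun i hi => ?_
      simp [hΦ, hi]
    -- This is `log B ≤ B - 1`, with the logarithm of each Jacobian factor bounded below by
    -- concavity and `g j` unchanged by `Φ j`.
    have hB : ∀ j, g j x - (V (Φ j x) - V x) - Real.log (r x).toReal + ∑ i, τ j i * Real.log (K i)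
        ≤ (B j x).toReal - 1 := by
      intro j
      have e : (B j x).toReal = Real.exp (g j x - V (Φ j x) - Real.log (ρ x).toReal
          + ∑ i, Real.log (F j i)) := by
        have hsum : Real.exp (∑ i, Real.log (F j i)) = ∏ i, F j i := by
          rw [Real.exp_sum]
          exact Finset.prod_congr rfl fun i _ => Real.exp_log (hF0 j i)
        simp only [B, indicator_of_mem hx, q]
        rw [ENNReal.toReal_div, ENNReal.toReal_mul, ENNReal.toReal_mul, hpr, hD, hgΦ,
          ENNReal.toReal_ofReal (Real.exp_pos _).le, Real.exp_add, Real.exp_sub, Real.exp_sub,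
          Real.exp_log hρpos, hsum, Real.exp_neg]
        field_simp
      have h1 := Real.add_one_le_exp (g j x - V (Φ j x) - Real.log (ρ x).toReal
          + ∑ i, Real.log (F j i))
      rw [← e, hlogρ] at h1
      have h2 : ∑ i, τ j i * Real.log (K i) ≤ ∑ i, Real.log (F j i) :=
        Finset.sum_le_sum fun i _ => mul_log_le_log_interpolation (hτ j i) (hK0 i)
      linarith
    have hsum := Finset.sum_le_sum fun j (_ : j ∈ Finset.univ) => hB j
    refine le_trans ?_ hsum
    rw [Finset.sum_add_distrib, Finset.sum_sub_distrib, Finset.sum_sub_distrib, Finset.sum_const]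
    have h3 : ∑ j, ∑ i, τ j i * Real.log (K i) = t * ℓ * ∑ i, Real.log (K i) := by
      have := sum_mul_ite_mem hS fun i => t * Real.log (K i)
      rw [← Finset.mul_sum] at this
      rw [show t * ℓ * ∑ i, Real.log (K i) = ℓ * (t * ∑ i, Real.log (K i)) by ring, ← this]
      refine Finset.sum_congr rfl fun j _ => Finset.sum_congr rfl fun i _ => ?_
      by_cases h : i ∈ S j <;> simp [τ, h]
    have h4 := hconv x (T x)
    simp only [← hΦ] at h4
    -- The Jacobian equation for `T` produces the same increment of `V` as `hconv`, so the potential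
    -- drops out.
    have h5 : t * ℓ * ∑ i, Real.log (K i)
        = t * ℓ * (Real.log (r x).toReal) + t * ℓ * (V (T x) - V x) := by
      rw [← mul_add]
      congr 1
      linarith
    rw [h3, h5, Finset.card_univ, Fintype.card_fin, nsmul_eq_mul]
    linarith
  have hint := integral_mono_ae (μ := μ)
    (f := fun x => ∑ j, g j x - (N - t * ℓ) * Real.log (r x).toReal)
    (g := fun x => ∑ j, ((B j x).toReal - 1))
    ((integrable_finsetSum _ fun j _ => hgi j).sub (hri.const_mul _))
    (integrable_finsetSum _ fun j _ => (hBi j).sub (integrable_const _))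
    (hEae.mono hpoint)
  rw [integral_sub (integrable_finsetSum _ fun j _ => hgi j) (hri.const_mul _),
    integral_finsetSum _ fun j _ => hgi j, integral_const_mul,
    integral_finsetSum (f := fun j x => (B j x).toReal - 1) _
      fun j _ => (hBi j).sub (integrable_const _)] at hint
  have hneg : ∑ j, ∫ x, ((B j x).toReal - 1) ∂μ ≤ 0 := by
    refine Finset.sum_nonpos fun j _ => ?_
    rw [integral_sub (hBi j) (integrable_const _)]
    simpa using hBint j
  linarith

end Entropy

/-! ### Potentials that are strongly convex and smooth -/

namespace ConvexSmooth

variable {d : ℕ} {U : EuclideanSpace ℝ (Fin d) → ℝ} {lam L : ℝ}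

theorem upper_bound (h : ConvexSmooth U lam L) (x w : EuclideanSpace ℝ (Fin d)) :
    U (x + w) ≤ U x + fderiv ℝ U x w + L / 2 * ‖w‖ ^ 2 := by
  have hgrad : ∀ y, fderiv ℝ U y w = ⟪gradient U y, w⟫_ℝ := fun y => by
    rw [gradient, InnerProductSpace.toDual_symm_apply]
  have hd : ∀ s : ℝ, HasDerivAt (fun s : ℝ => U (x + s • w) - s * fderiv ℝ U x w
      - L / 2 * s ^ 2 * ‖w‖ ^ 2)
      (fderiv ℝ U (x + s • w) w - fderiv ℝ U x w - L * s * ‖w‖ ^ 2) s := by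
    intro s
    have h1 : HasDerivAt (fun s : ℝ => x + s • w) w s := by
      simpa using ((hasDerivAt_id s).smul_const w).const_add x
    have h2 := (h.differentiable (x + s • w)).hasFDerivAt.comp_hasDerivAt s h1
    have h3 : HasDerivAt (fun s : ℝ => s * fderiv ℝ U x w) (fderiv ℝ U x w) s := by
      simpa using (hasDerivAt_id s).mul_const (fderiv ℝ U x w)
    have h4 : HasDerivAt (fun s : ℝ => L / 2 * s ^ 2 * ‖w‖ ^ 2) (L * s * ‖w‖ ^ 2) s := by
      refine (((hasDerivAt_pow 2 s).const_mul (L / 2)).mul_const (‖w‖ ^ 2)).congr_deriv ?_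
      push_cast
      ring
    exact (h2.sub h3).sub h4
  -- The derivative at `s` is a gradient increment paired with `w`, at most `L s ‖w‖²`, minus
  -- exactly that quantity.
  have hanti : AntitoneOn (fun s : ℝ => U (x + s • w) - s * fderiv ℝ U x w
      - L / 2 * s ^ 2 * ‖w‖ ^ 2) (Set.Icc 0 1) := by
    refine antitoneOn_of_deriv_nonpos (convex_Icc 0 1)
      (fun s _ => (hd s).continuousAt.continuousWithinAt)
      (fun s _ => (hd s).differentiableAt.differentiableWithinAt) fun s hs => ?_
    rw [interior_Icc] at hs
    rw [(hd s).deriv, hgrad, hgrad, ← inner_sub_left]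
    have h1 := real_inner_le_norm (gradient U (x + s • w) - gradient U x) w
    have h2 := h.lipschitz_gradient (x + s • w) x
    rw [add_sub_cancel_left, norm_smul, Real.norm_eq_abs, abs_of_pos hs.1] at h2
    nlinarith [norm_nonneg w]
  have := hanti (Set.left_mem_Icc.2 zero_le_one) (Set.right_mem_Icc.2 zero_le_one) zero_le_one
  simp at this
  linarith

theorem lam_le (h : ConvexSmooth U lam L) (hd : 0 < d) : lam ≤ L := by
  have h1 := h.lower_bound 0 (EuclideanSpace.single ⟨0, hd⟩ 1)
  have h2 := h.upper_bound 0 (EuclideanSpace.single ⟨0, hd⟩ 1)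
  simp at h1 h2
  linarith

/-- Orthonormality splits both quadratic bounds over the indices, so each index contributes `ℓ`
times on the left; one global lower bound in direction `a` then absorbs the total. -/
theorem sum_sub_le (h : ConvexSmooth U lam L) (hL : 0 < L)
    (b : OrthonormalBasis (Fin d) ℝ (EuclideanSpace ℝ (Fin d))) {N ℓ : ℕ}
    {S : Fin N → Finset (Fin d)} (hS : ∀ i, (Finset.univ.filter fun j => i ∈ S j).card = ℓ)
    (x : EuclideanSpace ℝ (Fin d)) (a : Fin d → ℝ) :
    ∑ j, (U (x + ∑ i ∈ S j, (lam / L * a i) • b i) - U x)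
      ≤ lam / L * ℓ * (U (x + ∑ i, a i • b i) - U x) := by
  have hnorm : ∀ (s : Finset (Fin d)) (c : Fin d → ℝ), ‖∑ i ∈ s, c i • b i‖ ^ 2
      = ∑ i ∈ s, c i ^ 2 := by
    intro s c
    rw [← real_inner_self_eq_norm_sq, b.orthonormal.inner_sum]
    exact Finset.sum_congr rfl fun i _ => by simp [sq]
  set t := lam / L with ht
  have hub : ∀ j, U (x + ∑ i ∈ S j, (t * a i) • b i) - U x
      ≤ ∑ i, (if i ∈ S j then t * (a i * fderiv ℝ U x (b i)) + t * lam / 2 * a i ^ 2 else 0) := by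
    intro j
    have h1 := h.upper_bound x (∑ i ∈ S j, (t * a i) • b i)
    rw [hnorm, map_sum] at h1
    rw [Finset.sum_ite_mem, Finset.univ_inter, Finset.sum_add_distrib]
    have e1 : ∑ i ∈ S j, fderiv ℝ U x ((t * a i) • b i)
        = ∑ i ∈ S j, t * (a i * fderiv ℝ U x (b i)) :=
      Finset.sum_congr rfl fun i _ => by rw [map_smul, smul_eq_mul, mul_assoc]
    have e2 : L / 2 * ∑ i ∈ S j, (t * a i) ^ 2 = ∑ i ∈ S j, t * lam / 2 * a i ^ 2 := by
      rw [Finset.mul_sum]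
      refine Finset.sum_congr rfl fun i _ => ?_
      -- The choice of time: the smoothness term `L t² / 2` becomes `t lam / 2`, the gain from
      -- strong convexity.
      have : L * t = lam := by rw [ht]; field_simp
      rw [← this]
      ring
    linarith
  refine (Finset.sum_le_sum fun j _ => hub j).trans ?_
  rw [sum_mul_ite_mem hS]
  have hlb := h.lower_bound x (∑ i, a i • b i)
  rw [hnorm, map_sum] at hlb
  have e : ∑ i, (t * (a i * fderiv ℝ U x (b i)) + t * lam / 2 * a i ^ 2)
      = t * (∑ i, fderiv ℝ U x (a i • b i) + lam / 2 * ∑ i, a i ^ 2) := by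
    rw [Finset.mul_sum, ← Finset.sum_add_distrib, Finset.mul_sum]
    refine Finset.sum_congr rfl fun i _ => ?_
    rw [map_smul, smul_eq_mul]
    ring
  rw [e]
  have ht0 : 0 ≤ t := div_nonneg h.lam_pos.le hL.le
  have h6 := mul_le_mul_of_nonneg_left (show ∑ i, fderiv ℝ U x (a i • b i)
    + lam / 2 * ∑ i, a i ^ 2 ≤ U (x + ∑ i, a i • b i) - U x by linarith)
    (mul_nonneg ht0 (Nat.cast_nonneg (α := ℝ) ℓ))
  linarith

end ConvexSmooth

/-! ### The variational bound for the relative entropy -/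

section Variational

open Filter Topology Set InformationTheory

/-- Nonnegativity is what permits Fatou. Where the upper cap is active, `1 ≤ n` suffices; otherwise
the expression dominates `klFun s`. -/
theorem klFun_truncation_nonneg {n : ℕ} (hn : 1 ≤ n) {s : ℝ} (hs : 0 ≤ s) :
    0 ≤ s * min (Real.log (max s (Real.exp (-n)))) n + 1 - s := by
  have hn' : (1 : ℝ) ≤ n := by exact_mod_cast hn
  rcases hs.eq_or_lt with rfl | hpos
  · simp
  rcases le_total (Real.log (max s (Real.exp (-n)))) n with h | h
  · rw [min_eq_left h]
    have h1 := klFun_nonneg hs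
    rw [klFun_apply] at h1
    have h2 := mul_le_mul_of_nonneg_left
      (Real.log_le_log hpos (le_max_left s (Real.exp (-(n : ℝ))))) hs
    linarith
  · rw [min_eq_right h]
    nlinarith

/-- If `∫ f dν ≤ C` for all bounded `f` with `∫ exp f dπ ≤ 1`, then `KL(ν | π) ≤ C`. -/
theorem klDiv_le_of_forall_integral_le {α : Type*} [MeasurableSpace α] {ν π : Measure α}
    [IsProbabilityMeasure ν] [IsProbabilityMeasure π] {C : ℝ}
    (h : ∀ f : α → ℝ, Measurable f → (∃ M, ∀ x, |f x| ≤ M) →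
      ∫⁻ x, ENNReal.ofReal (Real.exp (f x)) ∂π ≤ 1 → ∫ x, f x ∂ν ≤ C) :
    klDiv ν π ≤ ENNReal.ofReal C := by
  have hac : ν ≪ π := by
    refine Measure.AbsolutelyContinuous.mk fun A hA hA0 => ?_
    have hn : ∀ n : ℕ, n * ν.real A ≤ C := by
      intro n
      -- On a `π`-null set the test function may be arbitrarily large at no cost, which forces `ν A
      -- = 0`.
      have h1 := h (A.indicator fun _ => (n : ℝ)) (measurable_const.indicator hA)
        ⟨n, fun x => by by_cases hx : x ∈ A <;> simp [hx]⟩ (by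
          have : (fun x => ENNReal.ofReal (Real.exp (A.indicator (fun _ => (n : ℝ)) x)))
              =ᵐ[π] fun _ => 1 := by
            filter_upwards [measure_eq_zero_iff_ae_notMem.1 hA0] with x hx
            simp [hx]
          rw [lintegral_congr_ae this]
          simp)
      rw [integral_indicator_const _ hA, smul_eq_mul] at h1
      linarith
    by_contra hne
    have hpos : 0 < ν.real A := ENNReal.toReal_pos hne (measure_ne_top _ _)
    obtain ⟨n, hn'⟩ := exists_nat_gt (C / ν.real A)
    rw [div_lt_iff₀ hpos] at hn'
    linarith [hn n]
  let r : α → ℝ≥0∞ := ν.rnDeriv π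
  have hr : Measurable r := Measure.measurable_rnDeriv ν π
  let c : ℕ → α → ℝ := fun n x => min (Real.log (max (r x).toReal (Real.exp (-n)))) n
  have hcm : ∀ n, Measurable (c n) := fun n =>
    (hr.ennreal_toReal.max measurable_const).log.min measurable_const
  have hcb : ∀ n x, |c n x| ≤ n := fun n x => abs_le.2
    ⟨le_min (by
      rw [← Real.log_exp (-(n : ℝ))]
      exact Real.log_le_log (Real.exp_pos _) (by rw [Real.log_exp]; exact le_max_right _ _))
      (by linarith [Nat.cast_nonneg (α := ℝ) n]), min_le_right _ _⟩
  have hri : Integrable (fun x => (r x).toReal) π := Measure.integrable_toReal_rnDeriv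
  have hexp : ∀ n x, Real.exp (c n x) ≤ (r x).toReal + Real.exp (-n) := by
    intro n x
    have hpos : 0 < max (r x).toReal (Real.exp (-(n : ℝ))) := lt_max_of_lt_right (Real.exp_pos _)
    refine (Real.exp_le_exp.2 (min_le_left _ _)).trans ?_
    rw [Real.exp_log hpos]
    exact max_le_add_of_nonneg ENNReal.toReal_nonneg (Real.exp_pos _).le
  have hr1 : ∫⁻ x, r x ∂π = 1 := by
    rw [Measure.lintegral_rnDeriv hac, measure_univ]
  have hcC : ∀ n : ℕ, ∫ x, c n x ∂ν ≤ C + Real.log (1 + Real.exp (-n)) := by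
    intro n
    have hpos : 0 < 1 + Real.exp (-(n : ℝ)) := by positivity
    -- The lower truncation adds at most `exp (-n)` to the mass of `r`; subtracting this logarithm
    -- restores admissibility at a vanishing cost.
    have h1 := h (fun x => c n x - Real.log (1 + Real.exp (-n))) ((hcm n).sub_const _)
      ⟨n + |Real.log (1 + Real.exp (-n))|, fun x => (abs_sub _ _).trans
        (add_le_add (hcb n x) le_rfl)⟩ (by
        calc ∫⁻ x, ENNReal.ofReal (Real.exp (c n x - Real.log (1 + Real.exp (-n)))) ∂π
            ≤ ∫⁻ x, (r x + ENNReal.ofReal (Real.exp (-n))) *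
                (ENNReal.ofReal (1 + Real.exp (-n)))⁻¹ ∂π := by
              refine lintegral_mono fun x => ?_
              rw [Real.exp_sub, Real.exp_log hpos, div_eq_mul_inv,
                ENNReal.ofReal_mul (Real.exp_pos _).le, ENNReal.ofReal_inv_of_pos hpos]
              refine mul_le_mul_left ?_ _
              refine (ENNReal.ofReal_le_ofReal (hexp n x)).trans ?_
              rw [ENNReal.ofReal_add ENNReal.toReal_nonneg (Real.exp_pos _).le]
              exact add_le_add ENNReal.ofReal_toReal_le le_rfl
          _ = 1 := by
              have hz : ENNReal.ofReal (1 + Real.exp (-(n : ℝ))) ≠ 0 :=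
                (ENNReal.ofReal_pos.2 hpos).ne'
              rw [lintegral_mul_const' _ _ (ENNReal.inv_ne_top.2 hz),
                lintegral_add_left hr, hr1, lintegral_const, measure_univ, mul_one]
              nth_rewrite 1 [← ENNReal.ofReal_one]
              rw [← ENNReal.ofReal_add zero_le_one (Real.exp_pos _).le]
              exact ENNReal.mul_inv_cancel hz ENNReal.ofReal_ne_top
          _ ≤ 1 := le_rfl)
    have hci : Integrable (c n) ν := Integrable.of_bound (hcm n).aestronglyMeasurable n
      (Eventually.of_forall fun x => hcb n x)
    rw [integral_sub hci (integrable_const _)] at h1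
    simp at h1
    linarith
  let k : ℕ → α → ℝ := fun n x => (r x).toReal * c n x + 1 - (r x).toReal
  have hkm : ∀ n, Measurable (k n) := fun n =>
    ((hr.ennreal_toReal.mul (hcm n)).add_const 1).sub hr.ennreal_toReal
  have hkC : ∀ n : ℕ, 1 ≤ n → ∫⁻ x, ENNReal.ofReal (k n x) ∂π
      ≤ ENNReal.ofReal (C + Real.log (1 + Real.exp (-n))) := by
    intro n hn
    have hci : Integrable (c n) ν := Integrable.of_bound (hcm n).aestronglyMeasurable n
      (Eventually.of_forall fun x => hcb n x)
    have hci' : Integrable (fun x => (r x).toReal * c n x) π := by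
      have := (integrable_rnDeriv_smul_iff hac (f := c n)).2 hci
      simpa [smul_eq_mul] using this
    have hint : ∫ x, (r x).toReal * c n x ∂π = ∫ x, c n x ∂ν := by
      have := integral_rnDeriv_smul hac (f := c n)
      simpa [smul_eq_mul] using this
    have hki : Integrable (k n) π := (hci'.add (integrable_const 1)).sub hri
    rw [← ofReal_integral_eq_lintegral_ofReal hki
      (Eventually.of_forall fun x => klFun_truncation_nonneg hn ENNReal.toReal_nonneg)]
    refine ENNReal.ofReal_le_ofReal ?_
    have e1 : ∫ x, (r x).toReal ∂π = 1 := by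
      rw [integral_toReal hr.aemeasurable (Measure.rnDeriv_lt_top ν π), hr1, ENNReal.toReal_one]
    have e2 : ∫ x, k n x ∂π = ∫ x, c n x ∂ν := by
      simp only [k]
      rw [integral_sub (f := fun x => (r x).toReal * c n x + 1) (hci'.add (integrable_const 1)) hri,
        integral_add hci' (integrable_const 1),
        hint, e1]
      simp
    rw [e2]
    exact hcC n
  have hlim : ∀ x, Tendsto (fun n : ℕ => ENNReal.ofReal (k n x)) atTop
      (𝓝 (ENNReal.ofReal (klFun (r x).toReal))) := by
    intro x
    refine tendsto_const_nhds.congr' ?_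
    rcases (ENNReal.toReal_nonneg (a := r x)).eq_or_lt with h0 | h0
    · simp [k, ← h0, klFun_apply]
    obtain ⟨m, hm⟩ := exists_nat_ge |Real.log (r x).toReal|
    filter_upwards [eventually_ge_atTop m] with n hn
    have hmn : |Real.log (r x).toReal| ≤ n := hm.trans (by exact_mod_cast hn)
    have hb := abs_le.1 hmn
    have hle : Real.exp (-n) ≤ (r x).toReal := (Real.le_log_iff_exp_le h0).1 hb.1
    simp only [k, c, max_eq_left hle, min_eq_left hb.2, klFun_apply]
  rw [klDiv_eq_lintegral_klFun_of_ac hac]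
  have hCl : Tendsto (fun n : ℕ => ENNReal.ofReal (C + Real.log (1 + Real.exp (-n)))) atTop
      (𝓝 (ENNReal.ofReal C)) := by
    refine ENNReal.tendsto_ofReal ?_
    have h1 : Tendsto (fun n : ℕ => Real.exp (-(n : ℝ))) atTop (𝓝 0) :=
      Real.tendsto_exp_neg_atTop_nhds_zero.comp tendsto_natCast_atTop_atTop
    have h2 := (h1.const_add 1).log (by norm_num)
    simpa using h2.const_add C
  calc ∫⁻ x, ENNReal.ofReal (klFun (r x).toReal) ∂π
      = ∫⁻ x, liminf (fun n : ℕ => ENNReal.ofReal (k n x)) atTop ∂π :=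
        lintegral_congr fun x => (hlim x).liminf_eq.symm
    _ ≤ liminf (fun n : ℕ => ∫⁻ x, ENNReal.ofReal (k n x) ∂π) atTop :=
        lintegral_liminf_le fun n => (hkm n).ennreal_ofReal
    _ ≤ liminf (fun n : ℕ => ENNReal.ofReal (C + Real.log (1 + Real.exp (-n)))) atTop :=
        liminf_le_liminf ((eventually_ge_atTop 1).mono hkC)
    _ = ENNReal.ofReal C := hCl.liminf_eq

end Variational

/-! ### Integrals against the update along a frame -/

section FrameUpdate

variable {d ℓ : ℕ} {U : EuclideanSpace ℝ (Fin d) → ℝ}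

theorem framePoint_framePoint (x : EuclideanSpace ℝ (Fin d)) (v : Stiefel d ℓ)
    (s t : EuclideanSpace ℝ (Fin ℓ)) :
    framePoint (framePoint x v s) v t = framePoint x v (s + t) := by
  simp [framePoint, add_smul, Finset.sum_add_distrib, add_assoc]

theorem framePoint_zero (x : EuclideanSpace ℝ (Fin d)) (v : Stiefel d ℓ) :
    framePoint x v 0 = x := by
  simp [framePoint]

theorem measurable_framePoint (x : EuclideanSpace ℝ (Fin d)) (v : Stiefel d ℓ) :
    Measurable (framePoint x v) :=
  (continuous_framePoint.comp (Continuous.prodMk_right (x, v))).measurable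

/-- The normalizing constant of `frameUpdate`. -/
noncomputable def frameMass (U : EuclideanSpace ℝ (Fin d) → ℝ) (v : Stiefel d ℓ)
    (x : EuclideanSpace ℝ (Fin d)) : ℝ≥0∞ :=
  ∫⁻ s : EuclideanSpace ℝ (Fin ℓ), ENNReal.ofReal (Real.exp (-U (framePoint x v s)))

theorem frameMass_framePoint (v : Stiefel d ℓ) (x : EuclideanSpace ℝ (Fin d))
    (s : EuclideanSpace ℝ (Fin ℓ)) : frameMass U v (framePoint x v s) = frameMass U v x := by
  simp only [frameMass, framePoint_framePoint]
  exact lintegral_add_left_eq_self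
    (fun t => ENNReal.ofReal (Real.exp (-U (framePoint x v t)))) s

namespace ConvexSmooth

variable {lam L : ℝ}

theorem frameMass_eq (h : ConvexSmooth U lam L) (v : Stiefel d ℓ)
    (x : EuclideanSpace ℝ (Fin d)) : frameMass U v x
      = ENNReal.ofReal (∫ s : EuclideanSpace ℝ (Fin ℓ), Real.exp (-U (framePoint x v s))) :=
  (ofReal_integral_eq_lintegral_ofReal (h.integrable_exp_frame x v)
    (Filter.Eventually.of_forall fun _ => (Real.exp_pos _).le)).symm

theorem frameMass_ne_zero (h : ConvexSmooth U lam L) (v : Stiefel d ℓ)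
    (x : EuclideanSpace ℝ (Fin d)) : frameMass U v x ≠ 0 := by
  rw [h.frameMass_eq]
  exact (ENNReal.ofReal_pos.2 (integral_exp_pos (h.integrable_exp_frame x v))).ne'

theorem frameMass_ne_top (h : ConvexSmooth U lam L) (v : Stiefel d ℓ)
    (x : EuclideanSpace ℝ (Fin d)) : frameMass U v x ≠ ∞ := by
  rw [h.frameMass_eq]
  exact ENNReal.ofReal_ne_top

theorem lintegral_frameUpdate (h : ConvexSmooth U lam L) (v : Stiefel d ℓ)
    (x : EuclideanSpace ℝ (Fin d)) {f : EuclideanSpace ℝ (Fin d) → ℝ≥0∞} (hf : Measurable f) :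
    ∫⁻ y, f y ∂(frameUpdate U x v) = ∫⁻ s : EuclideanSpace ℝ (Fin ℓ), f (framePoint x v s) *
      ENNReal.ofReal (Real.exp (-U (framePoint x v s))) * (frameMass U v x)⁻¹ := by
  rw [frameUpdate, lintegral_map hf (measurable_framePoint x v), lintegral_tilted]
  refine lintegral_congr fun s => ?_
  rw [h.frameMass_eq, ENNReal.ofReal_div_of_pos (integral_exp_pos (h.integrable_exp_frame x v)),
    div_eq_mul_inv]
  ring

/-- Moving the base point within the affine subspace only translates the parameter `s`. Hence
averages against the update are constant along the frame, the invariance that the transport core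
requires. -/
theorem frameUpdate_framePoint (h : ConvexSmooth U lam L) (v : Stiefel d ℓ)
    (x : EuclideanSpace ℝ (Fin d)) (s : EuclideanSpace ℝ (Fin ℓ)) :
    frameUpdate U (framePoint x v s) v = frameUpdate U x v := by
  refine Measure.ext fun A hA => ?_
  rw [← lintegral_indicator_one hA, ← lintegral_indicator_one hA,
    h.lintegral_frameUpdate v _ (measurable_one.indicator hA),
    h.lintegral_frameUpdate v _ (measurable_one.indicator hA)]
  simp only [frameMass_framePoint, framePoint_framePoint]
  exact lintegral_add_left_eq_self (fun t => A.indicator 1 (framePoint x v t) *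
    ENNReal.ofReal (Real.exp (-U (framePoint x v t))) * (frameMass U v x)⁻¹) s

/-- `frameUpdate` leaves the target invariant. -/
theorem lintegral_lintegral_frameUpdate (h : ConvexSmooth U lam L) (v : Stiefel d ℓ)
    {f : EuclideanSpace ℝ (Fin d) → ℝ≥0∞} (hf : Measurable f) :
    ∫⁻ x, ∫⁻ y, f y ∂(frameUpdate U x v) ∂(target U) = ∫⁻ x, f x ∂(target U) := by
  have hUm := h.measurable
  let w : EuclideanSpace ℝ (Fin d) → ℝ≥0∞ := fun x => ENNReal.ofReal (Real.exp (-U x))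
  have hw : Measurable w := hUm.neg.exp.ennreal_ofReal
  have hfp : Measurable fun q : EuclideanSpace ℝ (Fin d) × EuclideanSpace ℝ (Fin ℓ) =>
      framePoint q.1 v q.2 := continuous_framePoint.measurable.comp
    ((measurable_fst.prodMk measurable_const).prodMk measurable_snd)
  have hfp' : Measurable fun q : EuclideanSpace ℝ (Fin d) × EuclideanSpace ℝ (Fin ℓ) =>
      framePoint q.1 v (-q.2) := hfp.comp (measurable_fst.prodMk measurable_snd.neg)
  have hZ : Measurable (frameMass U v) := Measurable.lintegral_prod_right' (hw.comp hfp)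
  have hinner : Measurable fun x => ∫⁻ y, f y ∂(frameUpdate U x v) :=
    (Measure.measurable_lintegral hf).comp
      ((measurable_frameUpdate hUm).comp (measurable_id.prodMk measurable_const))
  rw [target, lintegral_withDensity_eq_lintegral_mul _ hw hinner,
    lintegral_withDensity_eq_lintegral_mul _ hw hf]
  simp only [Pi.mul_apply]
  calc ∫⁻ x, w x * ∫⁻ y, f y ∂(frameUpdate U x v)
      = ∫⁻ x, ∫⁻ s : EuclideanSpace ℝ (Fin ℓ), w x * (f (framePoint x v s) *
          w (framePoint x v s) * (frameMass U v x)⁻¹) := by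
        refine lintegral_congr fun x => ?_
        rw [h.lintegral_frameUpdate v x hf, lintegral_const_mul' _ _ ENNReal.ofReal_ne_top]
    _ = ∫⁻ s : EuclideanSpace ℝ (Fin ℓ), ∫⁻ x, w x * (f (framePoint x v s) *
          w (framePoint x v s) * (frameMass U v x)⁻¹) := by
        refine lintegral_lintegral_swap (Measurable.aemeasurable ?_)
        exact (hw.comp measurable_fst).mul (((hf.comp hfp).mul (hw.comp hfp)).mul
          (hZ.comp measurable_fst).inv)
    _ = ∫⁻ s : EuclideanSpace ℝ (Fin ℓ), ∫⁻ x, w (framePoint x v (-s)) * (f x *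
          w x * (frameMass U v x)⁻¹) := by
        refine lintegral_congr fun s => ?_
        -- Translating `x` by `-s` along the frame moves the parameter off `f` and onto the outer
        -- weight, whose `s`-integral is the normalizing constant.
        rw [← lintegral_add_right_eq_self _ (∑ i, (-s) i • v.1 i)]
        refine lintegral_congr fun x => ?_
        change w (framePoint x v (-s)) * (f (framePoint (framePoint x v (-s)) v s) *
          w (framePoint (framePoint x v (-s)) v s) *
            (frameMass U v (framePoint x v (-s)))⁻¹) = _
        rw [framePoint_framePoint, neg_add_cancel, framePoint_zero, frameMass_framePoint]
    _ = ∫⁻ x, ∫⁻ s : EuclideanSpace ℝ (Fin ℓ), w (framePoint x v (-s)) * (f x *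
          w x * (frameMass U v x)⁻¹) := by
        refine lintegral_lintegral_swap (Measurable.aemeasurable ?_)
        exact (hw.comp (hfp'.comp measurable_swap)).mul (((hf.comp measurable_snd).mul
          (hw.comp measurable_snd)).mul (hZ.comp measurable_snd).inv)
    _ = ∫⁻ x, w x * f x := by
        refine lintegral_congr fun x => ?_
        have hm : Measurable fun s : EuclideanSpace ℝ (Fin ℓ) => w (framePoint x v (-s)) :=
          (hw.comp hfp').comp measurable_prodMk_left
        have hneg : ∫⁻ s : EuclideanSpace ℝ (Fin ℓ), w (framePoint x v (-s))
            = frameMass U v x :=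
          lintegral_neg_eq_self (fun s => w (framePoint x v s))
        rw [lintegral_mul_const _ hm, hneg, mul_comm (f x), mul_comm, mul_assoc,
          ENNReal.inv_mul_cancel (h.frameMass_ne_zero v x) (h.frameMass_ne_top v x), mul_one]

end ConvexSmooth

end FrameUpdate

/-! ### The hit-and-run step averages the frame updates -/

section Average

variable {d ℓ : ℕ} {U : EuclideanSpace ℝ (Fin d) → ℝ} {lam L : ℝ}

theorem ConvexSmooth.measurable_integral_frameUpdate (h : ConvexSmooth U lam L)
    {f : EuclideanSpace ℝ (Fin d) → ℝ} (hf : Measurable f) :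
    Measurable fun q : EuclideanSpace ℝ (Fin d) × Stiefel d ℓ =>
      ∫ y, f y ∂(frameUpdate U q.1 q.2) := by
  let η : Kernel (EuclideanSpace ℝ (Fin d) × Stiefel d ℓ) (EuclideanSpace ℝ (Fin d)) :=
    ⟨fun q => frameUpdate U q.1 q.2, measurable_frameUpdate h.measurable⟩
  have : IsMarkovKernel η := ⟨fun q => h.isProbabilityMeasure_frameUpdate q.1 q.2⟩
  exact (StronglyMeasurable.integral_kernel (κ := η) hf.stronglyMeasurable).measurable

theorem ConvexSmooth.abs_integral_frameUpdate_le (h : ConvexSmooth U lam L)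
    {f : EuclideanSpace ℝ (Fin d) → ℝ} {M : ℝ} (hM : ∀ x, |f x| ≤ M)
    (x : EuclideanSpace ℝ (Fin d)) (v : Stiefel d ℓ) :
    |∫ y, f y ∂(frameUpdate U x v)| ≤ M := by
  have := h.isProbabilityMeasure_frameUpdate x v
  have := norm_integral_le_of_norm_le_const (μ := frameUpdate U x v) (f := f) (C := M)
    (Filter.Eventually.of_forall hM)
  simpa using this

theorem ConvexSmooth.integral_bind_hitAndRun (h : ConvexSmooth U lam L) (hℓ : ℓ ≤ d)
    (μ : Measure (EuclideanSpace ℝ (Fin d))) [IsProbabilityMeasure μ]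
    {f : EuclideanSpace ℝ (Fin d) → ℝ} (hf : Measurable f) {M : ℝ} (hM : ∀ x, |f x| ≤ M) :
    ∫ y, f y ∂(μ.bind (hitAndRun U h.measurable hℓ))
      = ∫ v, ∫ x, ∫ y, f y ∂(frameUpdate U x v) ∂μ ∂(uniformFrame hℓ) := by
  let η : Kernel (EuclideanSpace ℝ (Fin d) × Stiefel d ℓ) (EuclideanSpace ℝ (Fin d)) :=
    ⟨fun q => frameUpdate U q.1 q.2, measurable_frameUpdate h.measurable⟩
  have hη : IsMarkovKernel η := ⟨fun q => h.isProbabilityMeasure_frameUpdate q.1 q.2⟩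
  have hHR := h.isMarkovKernel_hitAndRun (ℓ := ℓ) hℓ
  -- The step is one joint update kernel applied to independent draws of the point and the frame.
  have hbind : μ.bind (hitAndRun U h.measurable hℓ)
      = (η ∘ₖ Kernel.const Unit (μ.prod (uniformFrame hℓ))) () := by
    refine Measure.ext fun A hA => ?_
    rw [Kernel.comp_apply' _ _ _ hA, Measure.bind_apply hA (Kernel.aemeasurable _),
      Kernel.const_apply, lintegral_prod _ (Kernel.measurable_coe η hA).aemeasurable]
    exact lintegral_congr fun x => hitAndRun_apply _ _ _ hA
  have hint : Integrable f ((η ∘ₖ Kernel.const Unit (μ.prod (uniformFrame hℓ))) ()) :=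
    Integrable.of_bound hf.aestronglyMeasurable M (Filter.Eventually.of_forall hM)
  rw [hbind, Kernel.integral_comp hint, Kernel.const_apply]
  refine integral_prod_symm _ (Integrable.of_bound
    (h.measurable_integral_frameUpdate hf).aestronglyMeasurable M
    (Filter.Eventually.of_forall fun q => h.abs_integral_frameUpdate_le hM q.1 q.2))

end Average

/-! ### Columns of a Haar-distributed orthogonal matrix -/

section Columns

variable {d ℓ : ℕ}

theorem measurable_mul_right_orthogonalGroup (P : Matrix.orthogonalGroup (Fin d) ℝ) :
    Measurable fun A : Matrix.orthogonalGroup (Fin d) ℝ => A * P :=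
  (continuous_id.mul continuous_const).measurable

/-- Right multiplication commutes with left multiplication, so the image is again a left-invariant
probability measure, and Haar uniqueness applies. This makes every selection of columns a uniform
frame. -/
theorem map_mul_right_orthogonalHaar (P : Matrix.orthogonalGroup (Fin d) ℝ) :
    (orthogonalHaar d).map (fun A => A * P) = orthogonalHaar d := by
  have hH : (orthogonalHaar d).IsHaarMeasure := by unfold orthogonalHaar; infer_instance
  have hp : IsProbabilityMeasure ((orthogonalHaar d).map (fun A => A * P)) :=
    Measure.isProbabilityMeasure_map (measurable_mul_right_orthogonalGroup P).aemeasurable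
  have : ((orthogonalHaar d).map (fun A => A * P)).IsHaarMeasure :=
    Measure.isHaarMeasure_of_isCompact_nonempty_interior _ Set.univ isCompact_univ (by simp)
      (by simp) (by simp)
  exact Measure.isHaarMeasure_eq_of_isProbabilityMeasure _ _

/-- The permutation matrix with `A * permOrthogonal τ` having columns `A (τ 0), A (τ 1), …`. -/
noncomputable def permOrthogonal (τ : Equiv.Perm (Fin d)) : Matrix.orthogonalGroup (Fin d) ℝ :=
  ⟨(τ⁻¹).permMatrix ℝ, by
    rw [Matrix.mem_orthogonalGroup_iff, Matrix.transpose_permMatrix, ← Matrix.permMatrix_mul,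
      inv_mul_cancel, Matrix.permMatrix_one]⟩

/-- The frame formed by the columns `τ 0, …, τ (ℓ - 1)` of an orthogonal matrix. -/
noncomputable def permColumns (hℓ : ℓ ≤ d) (τ : Equiv.Perm (Fin d))
    (A : Matrix.orthogonalGroup (Fin d) ℝ) : Stiefel d ℓ :=
  firstColumns hℓ (A * permOrthogonal τ)

theorem permColumns_apply (hℓ : ℓ ≤ d) (τ : Equiv.Perm (Fin d))
    (A : Matrix.orthogonalGroup (Fin d) ℝ) (i : Fin ℓ) :
    (permColumns hℓ τ A).1 i = (firstColumns le_rfl A).1 (τ (Fin.castLE hℓ i)) := by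
  refine PiLp.ext fun k => ?_
  change ((A : Matrix (Fin d) (Fin d) ℝ) * (τ⁻¹).permMatrix ℝ) k (Fin.castLE hℓ i)
    = (A : Matrix (Fin d) (Fin d) ℝ) k (Fin.castLE le_rfl (τ (Fin.castLE hℓ i)))
  rw [Equiv.Perm.permMatrix, PEquiv.mul_toMatrix_toPEquiv]
  rfl

theorem measurable_permColumns (hℓ : ℓ ≤ d) (τ : Equiv.Perm (Fin d)) :
    Measurable (permColumns hℓ τ) :=
  (measurable_firstColumns hℓ).comp (measurable_mul_right_orthogonalGroup _)

theorem map_permColumns (hℓ : ℓ ≤ d) (τ : Equiv.Perm (Fin d)) :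
    (orthogonalHaar d).map (permColumns hℓ τ) = uniformFrame hℓ := by
  rw [uniformFrame]
  conv_rhs => rw [← map_mul_right_orthogonalHaar (permOrthogonal τ)]
  rw [Measure.map_map (measurable_firstColumns hℓ)
    (measurable_mul_right_orthogonalGroup _)]
  rfl

/-- The columns of an orthogonal matrix as an orthonormal basis. -/
theorem exists_orthonormalBasis_columns (A : Matrix.orthogonalGroup (Fin d) ℝ) :
    ∃ b : OrthonormalBasis (Fin d) ℝ (EuclideanSpace ℝ (Fin d)),
      ∀ i, b i = (firstColumns le_rfl A).1 i := by
  obtain ⟨b, hb⟩ := Orthonormal.exists_orthonormalBasis_extension_of_card_eq (𝕜 := ℝ)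
    (E := EuclideanSpace ℝ (Fin d)) (ι := Fin d) (by simp) (v := (firstColumns le_rfl A).1)
    (s := Set.univ) ((firstColumns le_rfl A).2.comp _ Subtype.val_injective)
  exact ⟨b, fun i => hb i (Set.mem_univ i)⟩

/-- The cyclic shifts of the first `ℓ` indices cover each index exactly `ℓ` times. -/
theorem card_cyclic_cover [NeZero d] (hℓ : ℓ ≤ d) (i : Fin d) :
    (Finset.univ.filter fun k : Fin d =>
      i ∈ Finset.univ.image fun m : Fin ℓ => Equiv.addRight k (Fin.castLE hℓ m)).card = ℓ := by
  -- Index `i` lies in the shift by `k` exactly when `k = i - m` modulo `d` for some `m < ℓ`, and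
  -- distinct `m` give distinct `k`.
  have : (Finset.univ.filter fun k : Fin d =>
      i ∈ Finset.univ.image fun m : Fin ℓ => Equiv.addRight k (Fin.castLE hℓ m))
      = Finset.univ.image fun m : Fin ℓ => i - Fin.castLE hℓ m := by
    ext k
    simp only [Finset.mem_filter, Finset.mem_univ, true_and, Finset.mem_image,
      Equiv.coe_addRight]
    refine exists_congr fun m => ?_
    rw [sub_eq_iff_eq_add, add_comm k, eq_comm]
  rw [this, Finset.card_image_of_injective _ fun a b hab =>
    Fin.castLE_injective hℓ (sub_right_injective hab), Finset.card_univ, Fintype.card_fin]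

end Columns

/-! ### Entropy contraction -/

section Contraction

open InformationTheory

variable {d ℓ : ℕ} {U : EuclideanSpace ℝ (Fin d) → ℝ} {lam L : ℝ}

theorem ConvexSmooth.sum_integral_le_of_basis (h : ConvexSmooth U lam L) (hd : 0 < d)
    [IsProbabilityMeasure (target U)]
    {μ : Measure (EuclideanSpace ℝ (Fin d))} [IsProbabilityMeasure μ] (hac : μ ≪ target U)
    (hllr : Integrable (llr μ (target U)) μ)
    (b : OrthonormalBasis (Fin d) ℝ (EuclideanSpace ℝ (Fin d))) {N : ℕ}
    {S : Fin N → Finset (Fin d)} (hS : ∀ i, (Finset.univ.filter fun j => i ∈ S j).card = ℓ)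
    {g : Fin N → EuclideanSpace ℝ (Fin d) → ℝ} (hg : ∀ j, Measurable (g j))
    (hgi : ∀ j, Integrable (g j) μ)
    (hginv : ∀ j x (a : Fin d → ℝ), g j (x + ∑ i ∈ S j, a i • b i) = g j x)
    (hg1 : ∀ j, ∫⁻ x, ENNReal.ofReal (Real.exp (g j x)) ∂(target U) ≤ 1) :
    ∑ j, ∫ x, g j x ∂μ ≤ (N - lam / L * ℓ) * ∫ x, llr μ (target U) x ∂μ := by
  have hL : 0 < L := h.lam_pos.trans_le (h.lam_le hd)
  -- Coordinates in the basis `b`: a volume-preserving identification under which `U ∘ e` is the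
  -- potential and the density of `μ` relative to the target plays the role of `r`.
  let e : (Fin d → ℝ) ≃ᵐ EuclideanSpace ℝ (Fin d) :=
    (MeasurableEquiv.toLp 2 (Fin d → ℝ)).trans b.repr.symm.toHomeomorph.toMeasurableEquiv
  have he : ∀ x, e x = ∑ i, x i • b i := fun x => (b.sum_repr_symm (WithLp.toLp 2 x)).symm
  have hmp : MeasurePreserving e volume volume :=
    b.measurePreserving_repr_symm.comp (PiLp.volume_preserving_toLp (Fin d))
  have hadd : ∀ (s : Finset (Fin d)) (x y : Fin d → ℝ), (∀ i ∉ s, x i = y i) →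
      e y = e x + ∑ i ∈ s, (y i - x i) • b i := by
    intro s x y hxy
    have h0 : ∑ i ∈ s, (y i - x i) • b i = ∑ i, (y i - x i) • b i := by
      refine Finset.sum_subset (Finset.subset_univ s) fun i _ hi => ?_
      rw [hxy i hi, sub_self, zero_smul]
    rw [h0, he, he, ← Finset.sum_add_distrib]
    exact Finset.sum_congr rfl fun i _ => by module
  let w : EuclideanSpace ℝ (Fin d) → ℝ≥0∞ := fun x => ENNReal.ofReal (Real.exp (-U x))
  have hw : Measurable w := h.measurable.neg.exp.ennreal_ofReal
  have hR : Measurable (μ.rnDeriv (target U)) := Measure.measurable_rnDeriv _ _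
  have htarget : ∀ {f : EuclideanSpace ℝ (Fin d) → ℝ≥0∞}, Measurable f →
      ∫⁻ x, f x ∂(target U) = ∫⁻ x, f (e x) * w (e x) := by
    intro f hf
    rw [target, lintegral_withDensity_eq_lintegral_mul _ hw hf,
      ← hmp.lintegral_comp (hw.mul hf)]
    exact lintegral_congr fun x => mul_comm _ _
  have hμ : ∀ {f : EuclideanSpace ℝ (Fin d) → ℝ≥0∞}, Measurable f →
      ∫⁻ x, f x ∂μ = ∫⁻ x, f (e x) * (μ.rnDeriv (target U) (e x) * w (e x)) := by
    intro f hf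
    have : μ.HaveLebesgueDecomposition (target U) :=
      Measure.haveLebesgueDecomposition_of_sigmaFinite μ (target U)
    rw [← lintegral_rnDeriv_mul hac hf.aemeasurable]
    refine (htarget (hR.mul hf)).trans (lintegral_congr fun x => ?_)
    simp only [Pi.mul_apply]
    ring
  have hμmap : μ.map e.symm
      = volume.withDensity fun x => μ.rnDeriv (target U) (e x) * w (e x) := by
    refine Measure.ext fun A hA => ?_
    rw [withDensity_apply _ hA, Measure.map_apply e.symm.measurable hA,
      ← lintegral_indicator_one (e.symm.measurable hA),
      hμ (measurable_one.indicator (e.symm.measurable hA)), ← lintegral_indicator hA]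
    refine lintegral_congr fun x => ?_
    by_cases hx : x ∈ A <;> simp [Set.indicator, hx]
  have hint : ∀ f : EuclideanSpace ℝ (Fin d) → ℝ, ∫ x, f (e x) ∂(μ.map e.symm) = ∫ x, f x ∂μ := by
    intro f
    rw [integral_map_equiv]
    simp
  have hintegrable : ∀ {f : EuclideanSpace ℝ (Fin d) → ℝ}, Integrable f μ →
      Integrable (fun x => f (e x)) (μ.map e.symm) := by
    intro f hf
    rw [integrable_map_equiv]
    refine hf.congr (Filter.Eventually.of_forall fun x => ?_)
    simp
  have key := sum_integral_le_of_interpolation (ℓ := ℓ) hS (V := fun x => U (e x))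
    (h.measurable.comp e.measurable) (r := fun x => μ.rnDeriv (target U) (e x))
    (hR.comp e.measurable)
    (by simpa [w] using (htarget (f := 1) measurable_one).symm)
    (by simpa [w] using (hμ (f := 1) measurable_one).symm)
    (t := lam / L)
    ⟨div_nonneg h.lam_pos.le hL.le, div_le_one_of_le₀ (h.lam_le hd) hL.le⟩
    (by
      intro x y
      have h1 := h.sum_sub_le hL b hS (e x) (fun i => y i - x i)
      rw [← hadd Finset.univ x y (by simp)] at h1
      refine le_trans (le_of_eq ?_) h1
      refine Finset.sum_congr rfl fun j _ => ?_
      rw [hadd (S j) x _ (fun i hi => by simp [hi])]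
      congr 3
      refine Finset.sum_congr rfl fun i hi => ?_
      rw [if_pos hi]
      congr 1
      ring)
    (g := fun j x => g j (e x)) (fun j => (hg j).comp e.measurable)
    (by
      intro j x y hxy
      rw [hadd (S j) x y hxy, hginv])
    (by
      intro j
      rw [← htarget (hg j).exp.ennreal_ofReal]
      exact hg1 j)
    hμmap (fun j => hintegrable (hgi j)) (hintegrable hllr)
  have hlog := hint (llr μ (target U))
  simp only [llr] at hlog
  rw [hlog] at key
  simp only [hint] at key
  exact key

/-- Jensen for the exponential under each update, then invariance of the target. -/
theorem ConvexSmooth.lintegral_exp_integral_frameUpdate_le (h : ConvexSmooth U lam L)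
    (v : Stiefel d ℓ) {f : EuclideanSpace ℝ (Fin d) → ℝ} (hf : Measurable f) {M : ℝ}
    (hM : ∀ x, |f x| ≤ M) :
    ∫⁻ x, ENNReal.ofReal (Real.exp (∫ y, f y ∂(frameUpdate U x v))) ∂(target U)
      ≤ ∫⁻ x, ENNReal.ofReal (Real.exp (f x)) ∂(target U) := by
  rw [← h.lintegral_lintegral_frameUpdate v hf.exp.ennreal_ofReal]
  refine lintegral_mono fun x => ?_
  have := h.isProbabilityMeasure_frameUpdate x v
  have hfi : Integrable f (frameUpdate U x v) :=
    Integrable.of_bound hf.aestronglyMeasurable M (Filter.Eventually.of_forall hM)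
  have hei : Integrable (fun y => Real.exp (f y)) (frameUpdate U x v) := by
    refine Integrable.of_bound hf.exp.aestronglyMeasurable (Real.exp M)
      (Filter.Eventually.of_forall fun y => ?_)
    rw [Real.norm_eq_abs, Real.abs_exp]
    exact Real.exp_le_exp.2 (le_of_abs_le (hM y))
  rw [← ofReal_integral_eq_lintegral_ofReal hei
    (Filter.Eventually.of_forall fun _ => (Real.exp_pos _).le)]
  exact ENNReal.ofReal_le_ofReal (convexOn_exp.map_integral_le Real.continuous_exp.continuousOn
    isClosed_univ (by simp) hfi hei)

theorem ConvexSmooth.integral_bind_le (h : ConvexSmooth U lam L) (hℓ : ℓ ≤ d) (hd : 0 < d)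
    [IsProbabilityMeasure (target U)]
    {μ : Measure (EuclideanSpace ℝ (Fin d))} [IsProbabilityMeasure μ] (hac : μ ≪ target U)
    (hllr : Integrable (llr μ (target U)) μ)
    {f : EuclideanSpace ℝ (Fin d) → ℝ} (hf : Measurable f) {M : ℝ} (hM : ∀ x, |f x| ≤ M)
    (hf1 : ∫⁻ x, ENNReal.ofReal (Real.exp (f x)) ∂(target U) ≤ 1) :
    ∫ y, f y ∂(μ.bind (hitAndRun U h.measurable hℓ))
      ≤ (1 - (ℓ : ℝ) / ((L / lam) * d)) * ∫ x, llr μ (target U) x ∂μ := by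
  have : NeZero d := ⟨hd.ne'⟩
  have hmeas := h.measurable_integral_frameUpdate (ℓ := ℓ) hf
  have habs := h.abs_integral_frameUpdate_le (ℓ := ℓ) hM
  rw [h.integral_bind_hitAndRun hℓ μ hf hM]
  set m : Stiefel d ℓ → ℝ := fun v => ∫ x, ∫ y, f y ∂(frameUpdate U x v) ∂μ with hm
  set K := ∫ x, llr μ (target U) x ∂μ
  have hmm : Measurable m :=
    (StronglyMeasurable.integral_prod_left' (μ := μ) hmeas.stronglyMeasurable).measurable
  have hmM : ∀ v, |m v| ≤ M := fun v => by
    have := norm_integral_le_of_norm_le_const (μ := μ) (C := M)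
      (f := fun x => ∫ y, f y ∂(frameUpdate U x v)) (Filter.Eventually.of_forall fun x => habs x v)
    simpa using this
  -- Each cyclic block of columns is a uniform frame, yet for fixed `A` all `d` blocks come from one
  -- orthonormal basis, so their sum can be bounded pointwise in `A`.
  let V : Fin d → Matrix.orthogonalGroup (Fin d) ℝ → Stiefel d ℓ := fun k =>
    permColumns hℓ (Equiv.addRight k)
  have hV : ∀ k, Measurable (V k) := fun k => measurable_permColumns hℓ _
  have hmV : ∀ k, Integrable (fun A => m (V k A)) (orthogonalHaar d) := fun k =>
    Integrable.of_bound (hmm.comp (hV k)).aestronglyMeasurable M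
      (Filter.Eventually.of_forall fun A => hmM _)
  have hk : ∀ k, ∫ v, m v ∂(uniformFrame hℓ) = ∫ A, m (V k A) ∂(orthogonalHaar d) := by
    intro k
    rw [← map_permColumns hℓ (Equiv.addRight k),
      integral_map (hV k).aemeasurable hmm.aestronglyMeasurable]
  have hA : ∀ A, ∑ k, m (V k A) ≤ (d - lam / L * ℓ) * K := by
    intro A
    obtain ⟨b, hb⟩ := exists_orthonormalBasis_columns A
    refine h.sum_integral_le_of_basis hd hac hllr b (card_cyclic_cover hℓ)
      (g := fun k x => ∫ y, f y ∂(frameUpdate U x (V k A)))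
      (fun k => hmeas.comp (measurable_id.prodMk measurable_const))
      (fun k => Integrable.of_bound
        (hmeas.comp (measurable_id.prodMk measurable_const)).aestronglyMeasurable M
        (Filter.Eventually.of_forall fun x => habs x _)) ?_
      (fun k => (h.lintegral_exp_integral_frameUpdate_le _ hf hM).trans hf1)
    intro k x a
    have hpt : x + ∑ i ∈ Finset.univ.image (fun i : Fin ℓ => Equiv.addRight k (Fin.castLE hℓ i)),
        a i • b i = framePoint x (V k A)
          (WithLp.toLp 2 fun i => a (Equiv.addRight k (Fin.castLE hℓ i))) := by
      rw [framePoint, Finset.sum_image fun i _ j _ hij =>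
        Fin.castLE_injective hℓ ((Equiv.addRight k).injective hij)]
      congr 1
      exact Finset.sum_congr rfl fun i _ => by rw [hb, permColumns_apply]
    change ∫ y, f y ∂(frameUpdate U (x + ∑ i ∈ Finset.univ.image
      (fun i : Fin ℓ => Equiv.addRight k (Fin.castLE hℓ i)), a i • b i) (V k A)) = _
    rw [hpt, h.frameUpdate_framePoint]
  have hsum : (d : ℝ) * ∫ v, m v ∂(uniformFrame hℓ) ≤ (d - lam / L * ℓ) * K := by
    calc (d : ℝ) * ∫ v, m v ∂(uniformFrame hℓ)
        = ∑ k : Fin d, ∫ A, m (V k A) ∂(orthogonalHaar d) := by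
          rw [← Finset.sum_congr rfl fun k _ => hk k, Finset.sum_const, Finset.card_univ,
            Fintype.card_fin, nsmul_eq_mul]
      _ = ∫ A, ∑ k, m (V k A) ∂(orthogonalHaar d) :=
          (integral_finsetSum _ fun k _ => hmV k).symm
      _ ≤ ∫ _A, (d - lam / L * ℓ) * K ∂(orthogonalHaar d) :=
          integral_mono (integrable_finsetSum _ fun k _ => hmV k) (integrable_const _) hA
      _ = (d - lam / L * ℓ) * K := by simp
  have hd' : (0 : ℝ) < d := Nat.cast_pos.2 hd
  have hL : 0 < L := h.lam_pos.trans_le (h.lam_le hd)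
  have hlam := h.lam_pos
  refine le_of_mul_le_mul_left (hsum.trans (le_of_eq ?_)) hd'
  field_simp

/-- Hit-and-run along full frames samples the target in one step. -/
theorem ConvexSmooth.integral_bind_le_zero (h : ConvexSmooth U lam L)
    [IsProbabilityMeasure (target U)]
    {μ : Measure (EuclideanSpace ℝ (Fin d))} [IsProbabilityMeasure μ]
    {f : EuclideanSpace ℝ (Fin d) → ℝ} (hf : Measurable f) {M : ℝ} (hM : ∀ x, |f x| ≤ M)
    (hf1 : ∫⁻ x, ENNReal.ofReal (Real.exp (f x)) ∂(target U) ≤ 1) :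
    ∫ y, f y ∂(μ.bind (hitAndRun U h.measurable le_rfl)) ≤ 0 := by
  rw [h.integral_bind_hitAndRun le_rfl μ hf hM]
  refine integral_nonpos fun v => integral_nonpos fun x => ?_
  -- A frame of `d` vectors is a basis, so every `z` is reached from `x`. The averaged `f` is then a
  -- constant whose exponential is at most 1.
  have hconst : ∀ z, frameUpdate U z v = frameUpdate U x v := by
    intro z
    obtain ⟨b, hb⟩ := Orthonormal.exists_orthonormalBasis_extension_of_card_eq (𝕜 := ℝ)
      (E := EuclideanSpace ℝ (Fin d)) (ι := Fin d) (by simp) (v := v.1)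
      (s := Set.univ) (v.2.comp _ Subtype.val_injective)
    have hz : z = framePoint x v (b.repr (z - x)) := by
      simp only [framePoint, ← hb _ (Set.mem_univ _)]
      rw [b.sum_repr, add_sub_cancel]
    rw [hz, h.frameUpdate_framePoint]
  have h1 := (h.lintegral_exp_integral_frameUpdate_le v hf hM).trans hf1
  simp only [hconst, lintegral_const, measure_univ, mul_one] at h1
  rw [ENNReal.ofReal_le_one, Real.exp_le_one_iff] at h1
  exact h1

end Contraction

end HitAndRun

theorem mainTheorem3 {d ℓ : ℕ} (hℓ_pos : 1 ≤ ℓ) (hℓ : ℓ ≤ d)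
    (U : EuclideanSpace ℝ (Fin d) → ℝ) (lam L : ℝ) (hU : HitAndRun.ConvexSmooth U lam L)
    (hπ : IsProbabilityMeasure (HitAndRun.target U))
    (μ : Measure (EuclideanSpace ℝ (Fin d))) (hμ : IsProbabilityMeasure μ) :
    InformationTheory.klDiv (μ.bind (HitAndRun.hitAndRun U hU.measurable hℓ)) (HitAndRun.target U)
      ≤ ENNReal.ofReal (1 - (ℓ : ℝ) / ((L / lam) * (d : ℝ))) *
        InformationTheory.klDiv μ (HitAndRun.target U) := by
  have hd : 0 < d := lt_of_lt_of_le hℓ_pos hℓ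
  have hHR := hU.isMarkovKernel_hitAndRun hℓ
  have hbind : IsProbabilityMeasure (μ.bind (HitAndRun.hitAndRun U hU.measurable hℓ)) := by
    infer_instance
  by_cases hfin : InformationTheory.klDiv μ (HitAndRun.target U) = ∞
  -- With infinite initial entropy the right side is infinite unless the factor vanishes, which
  -- requires `ℓ = d`; in that case one step already has zero entropy, so the convention `0 · ∞ = 0`
  -- is harmless.
  · rcases hℓ.eq_or_lt with rfl | hlt
    · refine le_trans (HitAndRun.klDiv_le_of_forall_integral_le (C := 0) ?_) (by simp)
      rintro f hf ⟨M, hM⟩ hf1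
      exact hU.integral_bind_le_zero hf hM hf1
    · have hκ : 1 ≤ L / lam := (one_le_div hU.lam_pos).2 (hU.lam_le hd)
      have hpos : 0 < 1 - (ℓ : ℝ) / ((L / lam) * (d : ℝ)) := by
        have h1 : (ℓ : ℝ) < d := by exact_mod_cast hlt
        have h2 : (d : ℝ) ≤ (L / lam) * d := le_mul_of_one_le_left (Nat.cast_nonneg d) hκ
        have h3 : (0 : ℝ) < d := Nat.cast_pos.2 hd
        rw [sub_pos, div_lt_one (by linarith)]
        linarith
      rw [hfin, ENNReal.mul_top (ENNReal.ofReal_pos.2 hpos).ne']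
      exact le_top
  · obtain ⟨hac, hllr⟩ := InformationTheory.klDiv_ne_top_iff.1 hfin
    have hK := InformationTheory.toReal_klDiv_of_measure_eq hac (by simp)
    rw [← ENNReal.ofReal_toReal hfin, ← ENNReal.ofReal_mul' ENNReal.toReal_nonneg, hK]
    refine HitAndRun.klDiv_le_of_forall_integral_le ?_
    rintro f hf ⟨M, hM⟩ hf1
    exact hU.integral_bind_le hℓ hd hac hllr hf hM hf1
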